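/- Let $F:\mathbb{C}\to\mathbb{C}$, $F(x)=xe^x$, and consider $\dot x=F(x)$ with real time. For $x\in\mathbb{C}$ let $I(x)\subset\mathbb{R}$ be the maximum interval of existence of the solution $\Phi(\cdot,x)$ with $\Phi(0,x)=x$, let $\Gamma(x)=\Phi(I(x),x)$ be the orbit of $x$ and $\Gamma_+(x)=\Phi(I(x)\cap[0,\infty),x)$ its positive semi-orbit. An orbit $\Gamma(x)$ is a positive (negative) separatrix if $I(x)\cap[0,\infty)$ (respectively $I(x)\cap(-\infty,0]$) is bounded. A solution blows up in finite positive (negative) time if it tends to infinity at a finite right (left) end of its maximum interval of existence. For $y\in\Gamma(x)$, with $\Gamma(x)$ not an equilibrium and not periodic, $\tau(x,y)=\int_{\Gamma(x,y)}\frac{dz}{F(z)}$ is the transit time from $x$ to $y$, where $\Gamma(x,y)$ is the piece of $\Gamma(x)$ from $x$ to $y$, parametrized by the flow. An equilibrium $a$ is a repelling (attracting) node if all solutions starting at points other than $a$ in some neighbourhood of $a$ tend to $a$ as $t\to-\infty$ (as $t\to\infty$) with a convergent polar angle around $a$, and a repelling (attracting) focus if they do so with a polar angle whose absolute value tends to infinity.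 Its basin is the set of all $x$ whose negative (positive) limit set is $\{a\}$. Then: 1. $0$ is the only equilibrium, and it is a repelling node. Let $\mathcal{N}$ be its basin. 2. $\partial\mathcal{N}=\Gamma\cup\overline{\Gamma}$, where $\Gamma$ is an orbit contained in the open upper half-plane and $\overline{\Gamma}=\{\bar z:z\in\Gamma\}$ is its complex conjugate. 3. For every $x\in\partial\mathcal{N}$: (a) the path component of $\partial\mathcal{N}$ that contains $x$ is the orbit $\Gamma(x)$; (b) $\Gamma(x)$ is a negative separatrix and the solution $\Phi(\cdot,x)$ blows up in finite negative time; more precisely $I(x)=(T,\infty)$ with $-\infty<T<0$, and $\operatorname{Re}\Phi(t,x)\to+\infty$ as $t\searrow T$; (c) as $t\to\infty$, $\operatorname{Re}\Phi(t,x)\to-\infty$ and $\operatorname{Im}\Phi(t,x)\to0$; (d) the transit time towards $-\infty$ is infinite: $\tau(x,y)\to\infty$ as $\operatorname{Re}y\to-\infty$ with $y\in\Gamma_+(x)$, and in particular $\sup_{y\in\Gamma_+(x)}\tau(x,y)=\infty$; (e) $\Gamma(x)$ is not a positive separatrix, and $\Phi(\cdot,x)$ does not blow up in finite positive time. 4.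 Consequently the following claim (part of Theorem 4.3 (3) of K. Broughan, *The structure of sectors of zeros of entire flows*, 2003) is false: for every entire function $G\not\equiv0$ and every node or focus $a$ of $\dot x=G(x)$ with basin $\mathcal{N}$, every path component of $\partial\mathcal{N}$ that consists of exactly one orbit, this orbit being a positive or a negative separatrix, is both a positive and a negative separatrix. -/

import Mathlib

open Set Filter Topology

noncomputable section

/-! Autonomous planar systems `x' = F x` with real time, for `F : ℂ → ℂ`. -/

/-- `γ` is a solution of `x' = F x`, `x 0 = x₀`, on the open interval `J` containing `0`. -/
def IsSolutionOn (F : ℂ → ℂ) (x₀ : ℂ) (J : Set ℝ) (γ : ℝ → ℂ) : Prop :=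
  IsOpen J ∧ J.OrdConnected ∧ (0 : ℝ) ∈ J ∧ γ 0 = x₀ ∧ IsIntegralCurveOn γ (fun _ => F) J

/-- The maximum interval of existence `I(x₀)`: the union of all open intervals on which the
initial value problem has a solution. -/
def maxInterval (F : ℂ → ℂ) (x₀ : ℂ) : Set ℝ :=
  {t | ∃ J γ, IsSolutionOn F x₀ J γ ∧ t ∈ J}

open Classical in
/-- The flow `Φ(t, x₀)`: the value at time `t ∈ I(x₀)` of a solution through `x₀` (solutions are
unique where `F` is locally Lipschitz, so the choice does not matter); it is `0` by convention
outside `I(x₀)`. -/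
def flow (F : ℂ → ℂ) (t : ℝ) (x₀ : ℂ) : ℂ :=
  if h : ∃ γ : ℝ → ℂ, ∃ J, IsSolutionOn F x₀ J γ ∧ t ∈ J then h.choose t else 0

/-- The orbit `Γ(x₀)`. -/
def orbit (F : ℂ → ℂ) (x₀ : ℂ) : Set ℂ :=
  (fun t => flow F t x₀) '' maxInterval F x₀

/-- The positive semi-orbit `Γ₊(x₀)`. -/
def posOrbit (F : ℂ → ℂ) (x₀ : ℂ) : Set ℂ :=
  (fun t => flow F t x₀) '' (maxInterval F x₀ ∩ Ici 0)

/-- The positive limit set `ω₊(Γ(x₀))`. -/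
def posLimitSet (F : ℂ → ℂ) (x₀ : ℂ) : Set ℂ :=
  {v | ∃ t : ℕ → ℝ, (∀ k, t k ∈ maxInterval F x₀) ∧ Tendsto t atTop atTop ∧
    Tendsto (fun k => flow F (t k) x₀) atTop (𝓝 v)}

/-- The negative limit set `ω₋(Γ(x₀))`. -/
def negLimitSet (F : ℂ → ℂ) (x₀ : ℂ) : Set ℂ :=
  {v | ∃ t : ℕ → ℝ, (∀ k, t k ∈ maxInterval F x₀) ∧ Tendsto t atTop atBot ∧
    Tendsto (fun k => flow F (t k) x₀) atTop (𝓝 v)}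

/-- `θ` is a continuous choice, on the time set `S`, of the polar angle at `a` of the solution
through `x`. -/
def IsPolarAngle (F : ℂ → ℂ) (a x : ℂ) (S : Set ℝ) (θ : ℝ → ℝ) : Prop :=
  ContinuousOn θ S ∧
    ∀ t ∈ S, flow F t x - a = (‖flow F t x - a‖ : ℂ) * Complex.exp ((θ t : ℂ) * Complex.I)

/-- Stable (attracting) node: all nearby solutions tend to `a` as `t → ∞`, with a polar angle
that converges. -/
def IsStableNode (F : ℂ → ℂ) (a : ℂ) : Prop :=
  F a = 0 ∧ ∃ δ > 0, ∀ x, x ≠ a → ‖x - a‖ < δ →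
    Ici 0 ⊆ maxInterval F x ∧ Tendsto (fun t => flow F t x) atTop (𝓝 a) ∧
      ∃ θ, IsPolarAngle F a x (Ici 0) θ ∧ ∃ l, Tendsto θ atTop (𝓝 l)

/-- Unstable (repelling) node: all nearby solutions tend to `a` as `t → -∞`, with a polar angle
that converges. -/
def IsUnstableNode (F : ℂ → ℂ) (a : ℂ) : Prop :=
  F a = 0 ∧ ∃ δ > 0, ∀ x, x ≠ a → ‖x - a‖ < δ →
    Iic 0 ⊆ maxInterval F x ∧ Tendsto (fun t => flow F t x) atBot (𝓝 a) ∧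
      ∃ θ, IsPolarAngle F a x (Iic 0) θ ∧ ∃ l, Tendsto θ atBot (𝓝 l)

/-- Stable (attracting) focus: all nearby solutions tend to `a` as `t → ∞`, spiralling
infinitely often around `a`. -/
def IsStableFocus (F : ℂ → ℂ) (a : ℂ) : Prop :=
  F a = 0 ∧ ∃ δ > 0, ∀ x, x ≠ a → ‖x - a‖ < δ →
    Ici 0 ⊆ maxInterval F x ∧ Tendsto (fun t => flow F t x) atTop (𝓝 a) ∧
      ∃ θ, IsPolarAngle F a x (Ici 0) θ ∧ Tendsto (fun t => |θ t|) atTop atTop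

/-- Unstable (repelling) focus: all nearby solutions tend to `a` as `t → -∞`, spiralling
infinitely often around `a`. -/
def IsUnstableFocus (F : ℂ → ℂ) (a : ℂ) : Prop :=
  F a = 0 ∧ ∃ δ > 0, ∀ x, x ≠ a → ‖x - a‖ < δ →
    Iic 0 ⊆ maxInterval F x ∧ Tendsto (fun t => flow F t x) atBot (𝓝 a) ∧
      ∃ θ, IsPolarAngle F a x (Iic 0) θ ∧ Tendsto (fun t => |θ t|) atBot atTop

/-- The basin of attraction of `a`. -/
def attractionBasin (F : ℂ → ℂ) (a : ℂ) : Set ℂ := {x | posLimitSet F x = {a}}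

/-- The basin of repulsion of `a`. -/
def repulsionBasin (F : ℂ → ℂ) (a : ℂ) : Set ℂ := {x | negLimitSet F x = {a}}

/-- `Γ` is a positive separatrix: an orbit whose maximum interval of existence is bounded in
positive time. -/
def IsPositiveSeparatrix (F : ℂ → ℂ) (Γ : Set ℂ) : Prop :=
  ∃ x₀, Γ = orbit F x₀ ∧ Bornology.IsBounded (maxInterval F x₀ ∩ Ici 0)

/-- `Γ` is a negative separatrix: an orbit whose maximum interval of existence is bounded in
negative time. -/
def IsNegativeSeparatrix (F : ℂ → ℂ) (Γ : Set ℂ) : Prop :=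
  ∃ x₀, Γ = orbit F x₀ ∧ Bornology.IsBounded (maxInterval F x₀ ∩ Iic 0)

/-- The solution through `x₀` tends to infinity in finite positive time. -/
def HasPositiveBlowUp (F : ℂ → ℂ) (x₀ : ℂ) : Prop :=
  ∃ T > 0, maxInterval F x₀ ∩ Ici 0 = Ico 0 T ∧
    Tendsto (fun t => flow F t x₀) (𝓝[<] T) (Bornology.cobounded ℂ)

/-- The solution through `x₀` tends to infinity in finite negative time. -/
def HasNegativeBlowUp (F : ℂ → ℂ) (x₀ : ℂ) : Prop :=
  ∃ T < 0, maxInterval F x₀ ∩ Iic 0 = Ioc T 0 ∧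
    Tendsto (fun t => flow F t x₀) (𝓝[>] T) (Bornology.cobounded ℂ)

/-- A time `t ∈ I(a)` with `Φ(t, a) = b`. It is unique if `b` lies on the orbit of `a` and this
orbit is neither an equilibrium nor periodic. -/
def timeFromTo (F : ℂ → ℂ) (a b : ℂ) : ℝ :=
  Classical.epsilon fun t : ℝ => t ∈ maxInterval F a ∧ flow F t a = b

/-- The transit time `τ(a, b) = ∫_{Γ(a,b)} dz / F(z)` for `b` on the non-periodic orbit `Γ` of `a`,
where the piece `Γ(a,b)` of `Γ` from `a` to `b` is parametrized by the flow. This complex line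
integral has a real value. -/
def transitTime (F : ℂ → ℂ) (a b : ℂ) : ℝ :=
  (∫ s in (0 : ℝ)..timeFromTo F a b,
    (1 / F (flow F s a)) * deriv (fun r => flow F r a) s).re

/-- The claim of blow-up in both time directions: for every node or focus `a` of an entire
vector field `F ≢ 0`, with basin `N`, if a path component of `∂N` consists of one separatrix, then
this separatrix is positive and negative, whatever the stability of `a`. -/
def TwoSidedBlowUpClaim : Prop :=
  ∀ F : ℂ → ℂ, Differentiable ℂ F → F ≠ 0 → ∀ (a : ℂ) (N : Set ℂ),
    ((IsStableNode F a ∨ IsStableFocus F a) ∧ N = attractionBasin F a ∨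
      (IsUnstableNode F a ∨ IsUnstableFocus F a) ∧ N = repulsionBasin F a) →
    ∀ x ∈ frontier N, pathComponentIn (frontier N) x = orbit F x →
      (IsPositiveSeparatrix F (orbit F x) ∨ IsNegativeSeparatrix F (orbit F x)) →
      IsPositiveSeparatrix F (orbit F x) ∧ IsNegativeSeparatrix F (orbit F x)

end

/-!
Write `F z = z eᶻ`. Away from `0` the complex time `T = timeFn`, a primitive of `1 / F`, satisfies
`T (Φ(t, x)) = T x + t`, so that `Im T` is constant along solutions in the upper half-plane. On
each vertical segment `Re z = a`, `0 < Im z < π`, the derivative of `Im T` has the sign of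
`reSpeed a b = a cos b - b sin b`, which changes at most once, and `Im T < 0` on the line `Im z =
π`. Hence `Im T` has exactly one zero on each segment (`exists_timeIm_zero`), and these zeros form
the graph `upperCurve` of a continuous function `bdryHeight`, on which `Re F < 0`.

The graph is invariant because `Im T` is constant. On it, solutions move to the left; they exist
for all positive times because `F` is bounded in the strip left of a vertical line, and cannot exist
for all negative times because `Re T`, which increases at unit speed, is bounded below to the
right of vertical lines: it increases along the positive real axis, and at points of the strip
above the axis it differs little from its values there (`exists_le_timeFn_re`). A solution that
stays bounded can be continued, so the real part tends to `+∞` at the finite left end of the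
interval of existence (`exists_isLeftwardSolution`). Since the real part takes all real values,
the graph is one orbit (`orbit_eq_upperCurve`).

The region `|Im z| < bdryHeight (Re z)` is invariant as well, and its solutions are bounded for
negative times: `Im T` is a positive constant along a solution in its upper half, whereas `Im T`
tends to `0` as `Re z → +∞`, and `Re F < 0` in the part of it that lies in `Re z ≤ 0`. The entire
function `ψ z = z exp (E z)` (`linearizer`), which extends `exp ∘ T` and vanishes only at `0`,
satisfies `ψ (Φ(t, x)) = eᵗ ψ x`, so that such solutions tend to `0` as `t → -∞`, with a
convergent polar angle. Therefore the region is the basin of `0`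
(`repulsionBasin_eq_innerRegion`), and its frontier consists of the graph and its complex
conjugate. The transit time along an orbit is the elapsed time, which is unbounded.
-/

/-! ### Maximal solutions and the flow of a continuously differentiable field -/

section ODE

variable {F : ℂ → ℂ} {x : ℂ} {J : Set ℝ} {γ η : ℝ → ℂ}

lemma IsSolutionOn.hasDerivAt (h : IsSolutionOn F x J γ) {t : ℝ} (ht : t ∈ J) :
    HasDerivAt γ (F (γ t)) t :=
  (h.2.2.2.2 t ht).hasDerivAt (h.1.mem_nhds ht)

lemma isSolutionOn_of_hasDerivAt (hJ : IsOpen J) (hJ' : J.OrdConnected) (h0 : (0 : ℝ) ∈ J)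
    (hx : γ 0 = x) (h : ∀ t ∈ J, HasDerivAt γ (F (γ t)) t) : IsSolutionOn F x J γ :=
  ⟨hJ, hJ', h0, hx, fun t ht => (h t ht).hasDerivWithinAt⟩

/-- Two solutions on a common interval that agree at one time agree throughout: the set of times
where they agree is relatively closed by continuity and relatively open by local uniqueness. -/
lemma eqOn_of_hasDerivAt_of_contDiff (hF : ContDiff ℝ 1 F) (hJ : IsOpen J) (hJ' : J.OrdConnected)
    (hγ : ∀ t ∈ J, HasDerivAt γ (F (γ t)) t) (hη : ∀ t ∈ J, HasDerivAt η (F (η t)) t)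
    {s : ℝ} (hs : s ∈ J) (h : γ s = η s) : EqOn γ η J := by
  have hopen : IsOpen {t | t ∈ J ∧ γ t = η t} := by
    rw [isOpen_iff_mem_nhds]
    rintro t ⟨ht, hte⟩
    obtain ⟨K, S, hS, hK⟩ := (hF.contDiffAt (x := γ t)).exists_lipschitzOnWith
    have e1 : ∀ᶠ r in 𝓝 t, HasDerivAt γ (F (γ r)) r ∧ γ r ∈ S := by
      filter_upwards [hJ.mem_nhds ht, (hγ t ht).continuousAt hS] with r h1 h2
      exact ⟨hγ r h1, h2⟩
    have e2 : ∀ᶠ r in 𝓝 t, HasDerivAt η (F (η r)) r ∧ η r ∈ S := by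
      filter_upwards [hJ.mem_nhds ht, (hη t ht).continuousAt (hte ▸ hS)] with r h1 h2
      exact ⟨hη r h1, h2⟩
    have := ODE_solution_unique_of_eventually (v := fun _ => F) (s := fun _ => S)
      (Eventually.of_forall fun _ => hK) e1 e2 hte
    filter_upwards [this, hJ.mem_nhds ht] with r h1 h2 using ⟨h2, h1⟩
  have hopen' : IsOpen {t | t ∈ J ∧ γ t ≠ η t} := by
    rw [isOpen_iff_mem_nhds]
    rintro t ⟨ht, hte⟩
    filter_upwards [hJ.mem_nhds ht,
      (hγ t ht).continuousAt.ne_iff_eventually_ne (hη t ht).continuousAt |>.1 hte] with r h1 h2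
    exact ⟨h1, h2⟩
  intro t ht
  by_contra hne
  obtain ⟨r, -, h1, h2⟩ := hJ'.isPreconnected _ _ hopen hopen'
    (fun r hr => by by_cases h : γ r = η r <;> simp [hr, h]) ⟨s, hs, hs, h⟩ ⟨t, ht, ht, hne⟩
  exact h2.2 h1.2

lemma flow_eq_of_isSolutionOn (hF : ContDiff ℝ 1 F) (h : IsSolutionOn F x J γ) {t : ℝ}
    (ht : t ∈ J) : flow F t x = γ t := by
  have hex : ∃ γ : ℝ → ℂ, ∃ J, IsSolutionOn F x J γ ∧ t ∈ J := ⟨γ, J, h, ht⟩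
  rw [flow, dif_pos hex]
  obtain ⟨J', h', ht'⟩ := hex.choose_spec
  refine eqOn_of_hasDerivAt_of_contDiff hF (J := J' ∩ J) (h'.1.inter h.1) (h'.2.1.inter h.2.1)
    (fun r hr => h'.hasDerivAt hr.1) (fun r hr => h.hasDerivAt hr.2) ⟨h'.2.2.1, h.2.2.1⟩ ?_
    ⟨ht', ht⟩
  rw [h'.2.2.2.1, h.2.2.2.1]

lemma IsSolutionOn.subset_maxInterval (h : IsSolutionOn F x J γ) : J ⊆ maxInterval F x :=
  fun _ ht => ⟨J, γ, h, ht⟩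

/-- The time of existence is bounded below uniformly on compact sets. -/
lemma exists_uniform_isSolutionOn (hF : ContDiff ℝ 1 F) {K : Set ℂ} (hK : IsCompact K) :
    ∃ ε > 0, ∀ y ∈ K, ∃ γ, IsSolutionOn F y (Ioo (-ε) ε) γ := by
  refine hK.induction_on (p := fun K => ∃ ε > 0, ∀ y ∈ K, ∃ γ, IsSolutionOn F y (Ioo (-ε) ε) γ)
    ⟨1, one_pos, by simp⟩ ?_ ?_ ?_
  · rintro s t hst ⟨ε, hε, h⟩
    exact ⟨ε, hε, fun y hy => h y (hst hy)⟩
  · rintro s t ⟨ε, hε, h⟩ ⟨ε', hε', h'⟩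
    have key : ∀ y δ, min ε ε' ≤ δ → (∃ γ, IsSolutionOn F y (Ioo (-δ) δ) γ) →
        ∃ γ, IsSolutionOn F y (Ioo (-min ε ε') (min ε ε')) γ := by
      rintro y δ hδ ⟨γ, hγ⟩
      have hpos := lt_min hε hε'
      refine ⟨γ, isSolutionOn_of_hasDerivAt isOpen_Ioo ordConnected_Ioo ⟨by linarith, hpos⟩
        hγ.2.2.2.1 fun r hr => hγ.hasDerivAt ⟨by linarith [hr.1], by linarith [hr.2]⟩⟩
    refine ⟨min ε ε', lt_min hε hε', fun y hy => hy.elim (fun hy => ?_) fun hy => ?_⟩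
    · exact key y ε (min_le_left _ _) (h y hy)
    · exact key y ε' (min_le_right _ _) (h' y hy)
  · intro y _
    obtain ⟨r, hr, ε, hε, h⟩ :=
      (hF.contDiffAt (x := y)).exists_forall_mem_closedBall_exists_eq_forall_mem_Ioo_hasDerivAt 0
    refine ⟨_, mem_nhdsWithin_of_mem_nhds (Metric.closedBall_mem_nhds y hr), ε, hε, fun z hz => ?_⟩
    obtain ⟨γ, h0, hγ⟩ := h z hz
    rw [zero_sub, zero_add] at hγ
    exact ⟨γ, isSolutionOn_of_hasDerivAt isOpen_Ioo ordConnected_Ioo ⟨by linarith, hε⟩ h0 hγ⟩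

lemma zero_mem_maxInterval (hF : ContDiff ℝ 1 F) (x : ℂ) : (0 : ℝ) ∈ maxInterval F x := by
  obtain ⟨ε, hε, h⟩ := exists_uniform_isSolutionOn hF (isCompact_singleton (x := x))
  obtain ⟨γ, hγ⟩ := h x rfl
  exact hγ.subset_maxInterval hγ.2.2.1

lemma isOpen_maxInterval : IsOpen (maxInterval F x) := by
  rw [isOpen_iff_mem_nhds]
  rintro t ⟨J, γ, h, ht⟩
  exact mem_of_superset (h.1.mem_nhds ht) h.subset_maxInterval

lemma ordConnected_maxInterval : (maxInterval F x).OrdConnected := by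
  rw [← isPreconnected_iff_ordConnected]
  have : maxInterval F x = ⋃₀ {J | ∃ γ, IsSolutionOn F x J γ} := by
    ext t; simp only [maxInterval, mem_ofPred_eq, mem_sUnion]; tauto
  rw [this]
  exact isPreconnected_sUnion 0 _ (fun J ⟨γ, h⟩ => h.2.2.1)
    fun J ⟨γ, h⟩ => isPreconnected_iff_ordConnected.2 h.2.1

lemma flow_zero (hF : ContDiff ℝ 1 F) (x : ℂ) : flow F 0 x = x := by
  obtain ⟨J, γ, h, ht⟩ := zero_mem_maxInterval hF x
  rw [flow_eq_of_isSolutionOn hF h ht, h.2.2.2.1]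

lemma hasDerivAt_flow (hF : ContDiff ℝ 1 F) {t : ℝ} (ht : t ∈ maxInterval F x) :
    HasDerivAt (fun t => flow F t x) (F (flow F t x)) t := by
  obtain ⟨J, γ, h, ht⟩ := ht
  rw [flow_eq_of_isSolutionOn hF h ht]
  refine (h.hasDerivAt ht).congr_of_eventuallyEq ?_
  filter_upwards [h.1.mem_nhds ht] with r hr using flow_eq_of_isSolutionOn hF h hr

lemma continuousOn_flow (hF : ContDiff ℝ 1 F) (x : ℂ) :
    ContinuousOn (fun t => flow F t x) (maxInterval F x) :=
  fun _ ht => (hasDerivAt_flow hF ht).continuousAt.continuousWithinAt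

lemma isSolutionOn_flow (hF : ContDiff ℝ 1 F) (x : ℂ) :
    IsSolutionOn F x (maxInterval F x) (fun t => flow F t x) :=
  isSolutionOn_of_hasDerivAt isOpen_maxInterval ordConnected_maxInterval
    (zero_mem_maxInterval hF x) (flow_zero hF x) fun _ ht => hasDerivAt_flow hF ht

lemma self_mem_orbit (hF : ContDiff ℝ 1 F) (x : ℂ) : x ∈ orbit F x :=
  ⟨0, zero_mem_maxInterval hF x, flow_zero hF x⟩

/-- A solution can be continued by a solution that starts at one of its points. -/
lemma add_mem_maxInterval (hF : ContDiff ℝ 1 F) {s u : ℝ} (hs : s ∈ maxInterval F x)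
    (hu : u ∈ maxInterval F (flow F s x)) : s + u ∈ maxInterval F x := by
  classical
  set y := flow F s x
  set J := maxInterval F x
  set J' := (fun r => r - s) ⁻¹' maxInterval F y
  have hJ : IsOpen J := isOpen_maxInterval
  have hJ' : IsOpen J' := isOpen_maxInterval.preimage (by fun_prop)
  have hc : J.OrdConnected := ordConnected_maxInterval
  have hc' : J'.OrdConnected :=
    ordConnected_maxInterval.preimage_mono fun a b h => sub_le_sub_right h s
  have hs' : s ∈ J' := by simp [J', zero_mem_maxInterval hF y]
  have hd' : ∀ r ∈ J', HasDerivAt (fun r => flow F (r - s) y) (F (flow F (r - s) y)) r :=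
    fun r hr => HasDerivAt.comp_sub_const r s (hasDerivAt_flow hF (x := y) hr)
  have hagree : EqOn (fun r => flow F r x) (fun r => flow F (r - s) y) (J ∩ J') :=
    eqOn_of_hasDerivAt_of_contDiff hF (hJ.inter hJ') (hc.inter hc')
      (fun r hr => hasDerivAt_flow hF hr.1) (fun r hr => hd' r hr.2) ⟨hs, hs'⟩
      (by simp [flow_zero hF, y])
  set γ : ℝ → ℂ := fun r => if r ∈ J then flow F r x else flow F (r - s) y
  have h1 : EqOn γ (fun r => flow F r x) J := fun r hr => if_pos hr
  have h2 : EqOn γ (fun r => flow F (r - s) y) J' := by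
    intro r hr
    by_cases h : r ∈ J
    · exact (h1 h).trans (hagree ⟨h, hr⟩)
    · exact if_neg h
  have h0 : (0 : ℝ) ∈ J := zero_mem_maxInterval hF x
  have : IsSolutionOn F x (J ∪ J') γ := by
    refine isSolutionOn_of_hasDerivAt (hJ.union hJ') ?_ (Or.inl h0)
      ((h1 h0).trans (flow_zero hF x)) ?_
    · exact (hc.isPreconnected.union s hs hs' hc'.isPreconnected).ordConnected
    · rintro r (hr | hr)
      · rw [h1 hr]
        exact (hasDerivAt_flow hF hr).congr_of_eventuallyEq
          (h1.eventuallyEq_of_mem (hJ.mem_nhds hr))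
      · rw [h2 hr]
        exact (hd' r hr).congr_of_eventuallyEq (h2.eventuallyEq_of_mem (hJ'.mem_nhds hr))
  exact this.subset_maxInterval (Or.inr (by simpa [J'] using hu))

/-- A solution that stays in a compact set on its way from time `0` to time `τ` exists until `τ`.
Both signs of `τ` are covered. -/
lemma mem_maxInterval_of_isCompact (hF : ContDiff ℝ 1 F) {K : Set ℂ} (hK : IsCompact K) {τ : ℝ}
    (h : ∀ t ∈ maxInterval F x, t ∈ uIcc 0 τ → flow F t x ∈ K) : τ ∈ maxInterval F x := by
  obtain ⟨ε, hε, hsol⟩ := exists_uniform_isSolutionOn hF hK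
  obtain ⟨n, hn⟩ := exists_nat_gt (|τ| / ε)
  have hn0 : (0 : ℝ) < n := lt_of_le_of_lt (by positivity) hn
  have hstep : |τ / n| < ε := by
    rw [abs_div, abs_of_pos hn0, div_lt_comm₀ hn0 hε]; exact hn
  -- the time interval is traversed in `n` steps, each shorter than the uniform existence time
  have key : ∀ k : ℕ, k ≤ n → (k : ℝ) * (τ / n) ∈ maxInterval F x := by
    intro k
    induction k with
    | zero => intro _; simpa using zero_mem_maxInterval hF x
    | succ k ih =>
      intro hk
      have hk' := ih (by omega)
      have hmem : (k : ℝ) * (τ / n) ∈ uIcc 0 τ := by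
        have h1 : (k : ℝ) / n ≤ 1 := by
          rw [div_le_one hn0]; exact_mod_cast (by omega : k ≤ n)
        have h2 : (0 : ℝ) ≤ (k : ℝ) / n := by positivity
        rw [show (k : ℝ) * (τ / n) = (k / n) * τ by ring, mem_uIcc]
        rcases le_total 0 τ with h | h
        · left; constructor <;> nlinarith
        · right; constructor <;> nlinarith
      obtain ⟨γ, hγ⟩ := hsol _ (h _ hk' hmem)
      have := add_mem_maxInterval hF hk' (hγ.subset_maxInterval (abs_lt.1 hstep))
      convert this using 1
      push_cast; ring
  have := key n le_rfl
  rwa [mul_div_cancel₀ _ hn0.ne'] at this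

/-- A continuous real function without zeros on a preconnected set has constant sign there. -/
lemma IsPreconnected.pos_of_ne_zero {α : Type*} [TopologicalSpace α] {J : Set α} {q : α → ℝ}
    (hJ : IsPreconnected J) (hq : ContinuousOn q J) (h0 : ∀ t ∈ J, q t ≠ 0) {s : α} (hs : s ∈ J)
    (hsq : 0 < q s) {t : α} (ht : t ∈ J) : 0 < q t := by
  by_contra hle
  obtain ⟨r, hr, hr0⟩ := hJ.intermediate_value ht hs hq ⟨not_lt.1 hle, hsq.le⟩
  exact h0 r hr hr0

section Conj

open ComplexConjugate

lemma hasDerivAt_conj {f : ℝ → ℂ} {f' : ℂ} {t : ℝ} (h : HasDerivAt f f' t) :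
    HasDerivAt (fun t => conj (f t)) (conj f') t :=
  (Complex.conjCLE.toContinuousLinearMap.hasFDerivAt.comp_hasDerivAt t h :)

lemma IsSolutionOn.conj (hc : ∀ z, F (conj z) = conj (F z)) (h : IsSolutionOn F x J γ) :
    IsSolutionOn F (conj x) J (fun t => conj (γ t)) :=
  isSolutionOn_of_hasDerivAt h.1 h.2.1 h.2.2.1 (by rw [h.2.2.2.1]) fun t ht => by
    rw [hc]; exact hasDerivAt_conj (h.hasDerivAt ht)

lemma maxInterval_conj (hc : ∀ z, F (conj z) = conj (F z)) (x : ℂ) :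
    maxInterval F (conj x) = maxInterval F x := by
  refine Subset.antisymm ?_ ?_
  · rintro t ⟨J, γ, h, ht⟩
    have := h.conj hc
    rw [Complex.conj_conj] at this
    exact this.subset_maxInterval ht
  · rintro t ⟨J, γ, h, ht⟩
    exact (h.conj hc).subset_maxInterval ht

lemma flow_conj (hF : ContDiff ℝ 1 F) (hc : ∀ z, F (conj z) = conj (F z)) {t : ℝ}
    (ht : t ∈ maxInterval F x) : flow F t (conj x) = conj (flow F t x) := by
  have h := isSolutionOn_flow hF x
  exact flow_eq_of_isSolutionOn hF (h.conj hc) ht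

lemma orbit_conj (hF : ContDiff ℝ 1 F) (hc : ∀ z, F (conj z) = conj (F z)) (x : ℂ) :
    orbit F (conj x) = conj '' orbit F x := by
  rw [orbit, orbit, image_image, maxInterval_conj hc]
  exact image_congr fun t ht => flow_conj hF hc ht

end Conj

end ODE

/-! ### The complex time of `x' = x eˣ` -/

section TimeFunction

open Real Complex

lemma exists_entire_primitive_dslope_exp_neg : ∃ E : ℂ → ℂ, E 0 = 0 ∧
    ∀ z, HasDerivAt E (dslope (fun z => cexp (-z)) 0 z) z := by
  have hd : DifferentiableOn ℂ (dslope (fun z => cexp (-z)) 0) univ :=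
    (Complex.differentiableOn_dslope univ_mem).2 (by fun_prop)
  obtain ⟨E, h0, hE⟩ :=
    (hd.isConservativeOn.isExactOn_univ (continuousOn_univ.1 hd.continuousOn)).with_val_at 0 0
  exact ⟨E, h0, fun z => hE z (mem_univ z)⟩

/-- The entire function with derivative `(e⁻ᶻ - 1) / z` that vanishes at `0`. -/
noncomputable def expPrimitive : ℂ → ℂ := exists_entire_primitive_dslope_exp_neg.choose

lemma expPrimitive_zero : expPrimitive 0 = 0 := exists_entire_primitive_dslope_exp_neg.choose_spec.1

lemma hasDerivAt_expPrimitive' (z : ℂ) :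
    HasDerivAt expPrimitive (dslope (fun z => cexp (-z)) 0 z) z :=
  exists_entire_primitive_dslope_exp_neg.choose_spec.2 z

lemma hasDerivAt_expPrimitive {z : ℂ} (hz : z ≠ 0) :
    HasDerivAt expPrimitive ((cexp (-z) - 1) / z) z := by
  have := hasDerivAt_expPrimitive' z
  rwa [dslope_of_ne _ hz, slope_def_field, neg_zero, Complex.exp_zero, sub_zero] at this

lemma differentiable_expPrimitive : Differentiable ℂ expPrimitive :=
  fun z => (hasDerivAt_expPrimitive' z).differentiableAt

lemma hasDerivAt_im_comp {f : ℝ → ℂ} {f' : ℂ} {t : ℝ} (h : HasDerivAt f f' t) :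
    HasDerivAt (fun t => (f t).im) f'.im t :=
  (Complex.imCLM.hasFDerivAt.comp_hasDerivAt t h :)

lemma hasDerivAt_re_comp {f : ℝ → ℂ} {f' : ℂ} {t : ℝ} (h : HasDerivAt f f' t) :
    HasDerivAt (fun t => (f t).re) f'.re t :=
  (Complex.reCLM.hasFDerivAt.comp_hasDerivAt t h :)

lemma expPrimitive_ofReal_im (a : ℝ) : (expPrimitive a).im = 0 := by
  have hd : ∀ a : ℝ, HasDerivAt (fun a : ℝ => (expPrimitive a).im) 0 a := by
    intro a
    have h := hasDerivAt_im_comp (hasDerivAt_expPrimitive' (a : ℂ)).comp_ofReal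
    convert h using 1
    rcases eq_or_ne a 0 with rfl | ha
    · have : HasDerivAt (fun z : ℂ => cexp (-z)) (cexp (-0) * -1) 0 :=
        (hasDerivAt_neg (0 : ℂ)).cexp
      rw [Complex.ofReal_zero, dslope_same, this.deriv]
      simp
    · rw [dslope_of_ne _ (by exact_mod_cast ha), slope_def_field,
        show (cexp (-(a : ℂ)) - cexp (-0)) / (a - 0) = ((Real.exp (-a) - 1) / a : ℝ) by
          push_cast; simp, Complex.ofReal_im]
  have := is_const_of_deriv_eq_zero (fun a => (hd a).differentiableAt) (fun a => (hd a).deriv) a 0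
  simpa [expPrimitive_zero] using this

/-- A primitive of `1 / (z eᶻ)`, the complex time of `x' = x eˣ`. The branch of the logarithm is cut
along the negative imaginary axis, so that the function is holomorphic at all points of the closed
upper half-plane other than `0`. -/
noncomputable def timeFn (z : ℂ) : ℂ := Complex.log (-I * z) + π / 2 * I + expPrimitive z

lemma hasDerivAt_timeFn {z : ℂ} (hz : 0 < z.im ∨ z.re ≠ 0) :
    HasDerivAt timeFn (cexp (-z) / z) z := by
  have hz0 : z ≠ 0 := by rintro rfl; simp at hz
  have hs : -I * z ∈ slitPlane := by simpa [mem_slitPlane_iff] using hz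
  have h1 : HasDerivAt (fun z : ℂ => -I * z) (-I) z := by
    simpa using (hasDerivAt_id z).const_mul (-I)
  have := ((h1.clog hs).add_const (π / 2 * I : ℂ)).add (hasDerivAt_expPrimitive hz0)
  have hI := I_ne_zero
  have he : -I / (-I * z) + (cexp (-z) - 1) / z = cexp (-z) / z := by
    field_simp
    ring
  rwa [he] at this

lemma timeFn_ofReal_im_of_pos {a : ℝ} (ha : 0 < a) : (timeFn a).im = 0 := by
  have : (Complex.log (-I * a)).im = -(π / 2) := by
    rw [Complex.log_im, show -I * (a : ℂ) = a * -I by ring, Complex.arg_real_mul _ ha,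
      Complex.arg_neg_I]
  rw [timeFn, Complex.add_im, Complex.add_im, this, expPrimitive_ofReal_im]
  simp

lemma timeFn_ofReal_im_of_neg {a : ℝ} (ha : a < 0) : (timeFn a).im = π := by
  have : (Complex.log (-I * a)).im = π / 2 := by
    rw [Complex.log_im, show -I * (a : ℂ) = (-a : ℝ) * I by push_cast; ring,
      Complex.arg_real_mul _ (neg_pos.2 ha), Complex.arg_I]
  rw [timeFn, Complex.add_im, Complex.add_im, this, expPrimitive_ofReal_im]
  simp

lemma continuousAt_timeFn {z : ℂ} (hz : 0 < z.im ∨ z.re ≠ 0) : ContinuousAt timeFn z :=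
  (hasDerivAt_timeFn hz).continuousAt

/-- The imaginary part of the complex time at `a + b i`. It is constant along solutions. -/
noncomputable def timeIm (a b : ℝ) : ℝ := (timeFn (a + b * I)).im

lemma timeIm_re_im (z : ℂ) : timeIm z.re z.im = (timeFn z).im := by
  rw [timeIm, Complex.re_add_im]

lemma timeIm_zero_of_pos {a : ℝ} (ha : 0 < a) : timeIm a 0 = 0 := by
  simp [timeIm, timeFn_ofReal_im_of_pos ha]

lemma timeIm_zero_of_neg {a : ℝ} (ha : a < 0) : timeIm a 0 = π := by
  simp [timeIm, timeFn_ofReal_im_of_neg ha]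

/-- The real part of `x eˣ` at `a + b i`, up to the factor `eᵃ`. -/
noncomputable def reSpeed (a b : ℝ) : ℝ := a * Real.cos b - b * Real.sin b

lemma hasDerivAt_timeFn_vertical {a b : ℝ} (h : 0 < b ∨ a ≠ 0) :
    HasDerivAt (fun b : ℝ => timeFn (a + b * I)) (cexp (-(a + b * I)) / (a + b * I) * I) b := by
  have h1 : HasDerivAt (fun b : ℝ => (a + b * I : ℂ)) I b := by
    simpa using (Complex.ofRealCLM.hasDerivAt (x := b)).mul_const I |>.const_add (a : ℂ)
  exact (hasDerivAt_timeFn (by simpa using h)).comp b h1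

lemma exp_neg_div_re (a b : ℝ) :
    (cexp (-(a + b * I)) / (a + b * I)).re = Real.exp (-a) / (a ^ 2 + b ^ 2) * reSpeed a b := by
  rw [Complex.div_re, Complex.exp_re, Complex.exp_im, reSpeed]
  simp [Complex.normSq_apply, ← pow_two]
  ring

lemma exp_neg_div_im (a b : ℝ) :
    (cexp (-(a + b * I)) / (a + b * I)).im =
      -(Real.exp (-a) / (a ^ 2 + b ^ 2) * (a * Real.sin b + b * Real.cos b)) := by
  rw [Complex.div_im, Complex.exp_re, Complex.exp_im]
  simp [Complex.normSq_apply, ← pow_two]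
  ring

lemma hasDerivAt_timeIm_vertical {a b : ℝ} (h : 0 < b ∨ a ≠ 0) :
    HasDerivAt (fun b => timeIm a b) (Real.exp (-a) / (a ^ 2 + b ^ 2) * reSpeed a b) b := by
  have := hasDerivAt_im_comp (hasDerivAt_timeFn_vertical h)
  rwa [Complex.mul_I_im, exp_neg_div_re] at this

lemma norm_timeFn_sub_le {a b : ℝ} (ha : 0 < a) (hb : 0 ≤ b) :
    ‖timeFn (a + b * I) - timeFn a‖ ≤ Real.exp (-a) / a * b := by
  have := (convex_Icc 0 b).norm_image_sub_le_of_norm_hasDerivWithin_le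
    (f := fun b : ℝ => timeFn (a + b * I)) (C := Real.exp (-a) / a)
    (fun x _ => (hasDerivAt_timeFn_vertical (b := x) (Or.inr ha.ne')).hasDerivWithinAt)
    (fun x _ => ?_) (left_mem_Icc.2 hb) (right_mem_Icc.2 hb)
  · simpa [abs_of_nonneg hb] using this
  · rw [norm_mul, norm_div, Complex.norm_exp, norm_I, mul_one]
    have h1 : a ≤ ‖(a + x * I : ℂ)‖ := by
      simpa using (le_abs_self _).trans (Complex.abs_re_le_norm (a + x * I : ℂ))
    have h2 : (-(a + x * I : ℂ)).re = -a := by simp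
    rw [h2]
    gcongr

lemma abs_timeIm_le {a b : ℝ} (ha : 0 < a) (hb : 0 ≤ b) :
    |timeIm a b| ≤ Real.exp (-a) / a * b := by
  have h := (Complex.abs_im_le_norm _).trans (norm_timeFn_sub_le ha hb)
  rwa [Complex.sub_im, timeFn_ofReal_im_of_pos ha, sub_zero] at h

/-- On the line `Im z = π` the function `timeIm` increases to its limit `0`. -/
lemma timeIm_pi_neg (a : ℝ) : timeIm a π < 0 := by
  have hd : ∀ a : ℝ, HasDerivAt (fun a => timeIm a π)
      (Real.exp (-a) / (a ^ 2 + π ^ 2) * π) a := by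
    intro a
    have h1 : HasDerivAt (fun a : ℝ => (a + π * I : ℂ)) 1 a := by
      simpa using (Complex.ofRealCLM.hasDerivAt (x := a)).add_const (π * I : ℂ)
    have := hasDerivAt_im_comp
      ((hasDerivAt_timeFn (z := a + π * I) (by simp [pi_pos])).comp a h1)
    rw [mul_one, exp_neg_div_im] at this
    simpa using! this
  have hmono : StrictMono fun a => timeIm a π :=
    strictMono_of_deriv_pos fun a => by
      rw [(hd a).deriv]
      have := pi_pos
      positivity
  have hlim : Tendsto (fun a => timeIm a π) atTop (𝓝 0) := by
    have h0 : Tendsto (fun a : ℝ => Real.exp (-a) / a * π) atTop (𝓝 0) := by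
      simpa using (((Real.tendsto_exp_neg_atTop_nhds_zero).div_atTop tendsto_id).mul_const π)
    refine squeeze_zero_norm' ?_ h0
    filter_upwards [eventually_gt_atTop 0] with a ha
    exact abs_timeIm_le ha pi_pos.le
  exact (hmono (lt_add_one a)).trans_le (hmono.monotone.ge_of_tendsto hlim _)

/-! ### The boundary curve -/

lemma reSpeed_pos_of_lt {a b b' : ℝ} (ha : 0 < a) (hb : b < π) (h : 0 ≤ reSpeed a b)
    (h0 : 0 < b') (hb' : b' < b) : 0 < reSpeed a b' := by
  rw [reSpeed] at *
  have hs : 0 < Real.sin b := sin_pos_of_pos_of_lt_pi (by linarith) hb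
  have hb2 : b < π / 2 := by
    by_contra hle
    have : Real.cos b ≤ 0 := cos_nonpos_of_pi_div_two_le_of_le (by linarith) (by linarith)
    nlinarith
  have h1 : Real.cos b < Real.cos b' := cos_lt_cos_of_nonneg_of_le_pi_div_two h0.le hb2.le hb'
  have h2 : Real.sin b' < Real.sin b := sin_lt_sin_of_lt_of_le_pi_div_two (by linarith) hb2.le hb'
  have h3 : 0 < Real.sin b' := sin_pos_of_pos_of_lt_pi h0 (by linarith)
  nlinarith

lemma reSpeed_pos_of_gt {a b b' : ℝ} (ha : a ≤ 0) (hb : 0 < b) (h : 0 ≤ reSpeed a b)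
    (hb' : b < b') (hπ : b' < π) : 0 < reSpeed a b' := by
  rw [reSpeed] at *
  have hs : 0 < Real.sin b := sin_pos_of_pos_of_lt_pi hb (by linarith)
  have hs' : 0 < Real.sin b' := sin_pos_of_pos_of_lt_pi (by linarith) hπ
  have hb2 : π / 2 < b := by
    by_contra hle
    have : 0 ≤ Real.cos b := cos_nonneg_of_mem_Icc ⟨by linarith, by linarith⟩
    nlinarith
  have hc : Real.cos b < 0 := cos_neg_of_pi_div_two_lt_of_lt hb2 (by linarith)
  have hc' : Real.cos b' < 0 := cos_neg_of_pi_div_two_lt_of_lt (by linarith) (by linarith)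
  -- Jordan's inequality for `b' - b` gives `b' - b < b * Real.sin (b' - b)`, as `b > π / 2`
  have hj : b' - b < b * Real.sin (b' - b) := by
    have h1 := Real.mul_le_sin (x := b' - b) (by linarith) (by linarith)
    have h3 : 0 < 2 / π * (b' - b) := by
      have := sub_pos.2 hb'
      positivity
    calc b' - b = π / 2 * (2 / π * (b' - b)) := by field_simp
      _ < b * (2 / π * (b' - b)) := by gcongr
      _ ≤ b * Real.sin (b' - b) := by gcongr
  have hk : (b' - b) * (Real.sin b' * -Real.cos b) ≤ b' - b := by
    have : Real.sin b' * -Real.cos b ≤ 1 := by nlinarith [sin_le_one b', neg_one_le_cos b]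
    nlinarith
  have hsub : Real.sin (b' - b) = Real.sin b' * Real.cos b - Real.cos b' * Real.sin b := sin_sub _ _
  rw [hsub] at hj
  have key : 0 < (a * Real.cos b' - b' * Real.sin b') * -Real.cos b := by nlinarith
  exact pos_of_mul_pos_left key (by linarith)

/-- In the strip `0 < Im z < π`, the function `timeIm a` changes sign exactly once on each vertical
segment, from positive to negative, and it decreases strictly there. -/
lemma exists_timeIm_zero (a : ℝ) : ∃ β, 0 < β ∧ β < π ∧ timeIm a β = 0 ∧
    (∀ b, 0 < b → b < β → 0 < timeIm a b) ∧ (∀ b, β < b → b ≤ π → timeIm a b < 0) ∧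
    reSpeed a β < 0 ∧ (a ≤ 0 → ∀ b, 0 < b → b < β → reSpeed a b < 0) := by
  have hfac : ∀ b, 0 < b → 0 < Real.exp (-a) / (a ^ 2 + b ^ 2) := fun b hb => by positivity
  have hcont : ContinuousOn (timeIm a) (Ioi 0) := fun b hb =>
    (hasDerivAt_timeIm_vertical (Or.inl hb)).continuousAt.continuousWithinAt
  -- `timeIm a` is positive at some point above the real axis
  have hpos : ∃ b₀, 0 < b₀ ∧ b₀ < π ∧ 0 < timeIm a b₀ := by
    rcases lt_trichotomy a 0 with ha | rfl | ha
    · have h1 : ContinuousAt (timeIm a) 0 :=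
        (hasDerivAt_timeIm_vertical (Or.inr ha.ne)).continuousAt
      have h2 : ∀ᶠ b in 𝓝 (0 : ℝ), 0 < timeIm a b :=
        h1.eventually_const_lt (by rw [timeIm_zero_of_neg ha]; exact pi_pos)
      obtain ⟨b, hb, h3⟩ := ((h2.filter_mono nhdsWithin_le_nhds).and
        (Ioo_mem_nhdsGT pi_pos)).exists
      exact ⟨b, h3.1, h3.2, hb⟩
    · have h1 : Continuous (fun b : ℝ => (expPrimitive (b * I)).im) := by
        have := differentiable_expPrimitive.continuous
        fun_prop
      have h2 : ∀ᶠ b : ℝ in 𝓝 0, -(π / 2) < (expPrimitive (b * I)).im :=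
        h1.continuousAt.eventually_const_lt (by simp [expPrimitive_zero, pi_pos])
      obtain ⟨b, hb, h3⟩ := ((h2.filter_mono nhdsWithin_le_nhds).and
        (Ioo_mem_nhdsGT pi_pos)).exists
      refine ⟨b, h3.1, h3.2, ?_⟩
      have h4 : (Complex.log (-I * (b * I))).im = 0 := by
        rw [show -I * (b * I) = b by linear_combination (-b : ℂ) * I_mul_I, Complex.log_im,
          Complex.arg_ofReal_of_nonneg h3.1.le]
      have h5 : timeIm 0 b = π / 2 + (expPrimitive (b * I)).im := by
        simpa [timeIm, timeFn] using h4
      linarith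
    · have h1 : ContinuousAt (reSpeed a) 0 := by unfold reSpeed; fun_prop
      have h2 : ∀ᶠ b in 𝓝 (0 : ℝ), 0 < reSpeed a b :=
        h1.eventually_const_lt (by simpa [reSpeed] using ha)
      obtain ⟨b, hb, h3⟩ := ((h2.filter_mono nhdsWithin_le_nhds).and
        (Ioo_mem_nhdsGT pi_pos)).exists
      refine ⟨b, h3.1, h3.2, ?_⟩
      have hm : StrictMonoOn (timeIm a) (Icc 0 b) := by
        refine strictMonoOn_of_deriv_pos (convex_Icc _ _) (fun x _ =>
          (hasDerivAt_timeIm_vertical (Or.inr ha.ne')).continuousAt.continuousWithinAt)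
          fun x hx => ?_
        rw [interior_Icc] at hx
        rw [(hasDerivAt_timeIm_vertical (Or.inr ha.ne')).deriv]
        exact mul_pos (hfac x hx.1) (reSpeed_pos_of_lt ha h3.2 hb.le hx.1 hx.2)
      have := hm (left_mem_Icc.2 h3.1.le) (right_mem_Icc.2 h3.1.le) h3.1
      rwa [timeIm_zero_of_pos ha] at this
  obtain ⟨b₀, hb₀, hb₀π, hb₀pos⟩ := hpos
  obtain ⟨β, hβ, hβ0⟩ := intermediate_value_Ioo' hb₀π.le
    (hcont.mono fun x hx => hb₀.trans_le hx.1) ⟨timeIm_pi_neg a, hb₀pos⟩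
  have hβpos : 0 < β := hb₀.trans hβ.1
  have hanti : ∀ s : Set ℝ, Convex ℝ s → s ⊆ Ioi 0 → (∀ x ∈ interior s, reSpeed a x < 0) →
      StrictAntiOn (timeIm a) s := by
    intro s hs hs0 hneg
    refine strictAntiOn_of_deriv_neg hs (hcont.mono hs0) fun x hx => ?_
    have hx0 : 0 < x := hs0 (interior_subset hx)
    rw [(hasDerivAt_timeIm_vertical (Or.inl hx0)).deriv]
    exact mul_neg_of_pos_of_neg (hfac x hx0) (hneg x hx)
  rcases lt_or_ge 0 a with ha | ha
  · have hA : ∀ b, 0 < b → b < π → timeIm a b ≤ 0 → reSpeed a b < 0 := by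
      intro b hb hbπ hle
      by_contra hge
      have hm : StrictMonoOn (timeIm a) (Icc 0 b) := by
        refine strictMonoOn_of_deriv_pos (convex_Icc _ _) (fun x _ =>
          (hasDerivAt_timeIm_vertical (Or.inr ha.ne')).continuousAt.continuousWithinAt)
          fun x hx => ?_
        rw [interior_Icc] at hx
        rw [(hasDerivAt_timeIm_vertical (Or.inr ha.ne')).deriv]
        exact mul_pos (hfac x hx.1) (reSpeed_pos_of_lt ha hbπ (not_lt.1 hge) hx.1 hx.2)
      have := hm (left_mem_Icc.2 hb.le) (right_mem_Icc.2 hb.le) hb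
      rw [timeIm_zero_of_pos ha] at this
      exact this.not_ge hle
    have hB : ∀ b, 0 < b → b < π → timeIm a b ≤ 0 → StrictAntiOn (timeIm a) (Icc b π) := by
      intro b hb hbπ hle
      refine hanti _ (convex_Icc _ _) (fun x hx => hb.trans_le hx.1) fun x hx => ?_
      rw [interior_Icc] at hx
      by_contra hge
      exact (hA b hb hbπ hle).not_gt (reSpeed_pos_of_lt ha hx.2 (not_lt.1 hge) hb hx.1)
    refine ⟨β, hβpos, hβ.2, hβ0, fun b hb hbβ => ?_, fun b hb hbπ => ?_,
      hA β hβpos hβ.2 hβ0.le, fun h => absurd h ha.not_ge⟩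
    · by_contra hle
      have := hB b hb (hbβ.trans hβ.2) (not_lt.1 hle) ⟨le_rfl, (hbβ.trans hβ.2).le⟩
        ⟨hbβ.le, hβ.2.le⟩ hbβ
      linarith
    · have := hB β hβpos hβ.2 hβ0.le ⟨le_rfl, hβ.2.le⟩ ⟨hb.le, hbπ⟩ hb
      linarith
  · have hA : ∀ b, 0 < b → b < π → 0 ≤ timeIm a b → reSpeed a b < 0 := by
      intro b hb hbπ hle
      by_contra hge
      have hm : StrictMonoOn (timeIm a) (Icc b π) := by
        refine strictMonoOn_of_deriv_pos (convex_Icc _ _)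
          (hcont.mono fun x hx => hb.trans_le hx.1) fun x hx => ?_
        rw [interior_Icc] at hx
        rw [(hasDerivAt_timeIm_vertical (Or.inl (hb.trans hx.1))).deriv]
        exact mul_pos (hfac x (hb.trans hx.1))
          (reSpeed_pos_of_gt ha hb (not_lt.1 hge) hx.1 hx.2)
      have := hm (left_mem_Icc.2 hbπ.le) (right_mem_Icc.2 hbπ.le) hbπ
      linarith [timeIm_pi_neg a]
    have hA' : ∀ b, 0 < b → b < π → 0 ≤ timeIm a b → ∀ x, 0 < x → x < b → reSpeed a x < 0 := by
      intro b hb hbπ hle x hx hxb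
      by_contra hge
      exact (hA b hb hbπ hle).not_gt (reSpeed_pos_of_gt ha hx (not_lt.1 hge) hxb hbπ)
    have hB : ∀ b, 0 < b → b < π → 0 ≤ timeIm a b → StrictAntiOn (timeIm a) (Ioc 0 b) := by
      intro b hb hbπ hle
      refine hanti _ (convex_Ioc _ _) (fun x hx => hx.1) fun x hx => ?_
      rw [interior_Ioc] at hx
      exact hA' b hb hbπ hle x hx.1 hx.2
    refine ⟨β, hβpos, hβ.2, hβ0, fun b hb hbβ => ?_, fun b hb hbπ => ?_,
      hA β hβpos hβ.2 hβ0.ge, fun _ => hA' β hβpos hβ.2 hβ0.ge⟩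
    · have := hB β hβpos hβ.2 hβ0.ge ⟨hb, hbβ.le⟩ ⟨hβpos, le_rfl⟩ hbβ
      linarith
    · rcases hbπ.eq_or_lt with rfl | hbπ
      · exact timeIm_pi_neg a
      · by_contra hle
        have := hB b (hβpos.trans hb) hbπ (not_lt.1 hle) ⟨hβpos, hb.le⟩
          ⟨hβpos.trans hb, le_rfl⟩ hb
        linarith

/-- The height of the boundary curve above `a`: the zero of `timeIm a` in `(0, π)`. -/
noncomputable def bdryHeight (a : ℝ) : ℝ := (exists_timeIm_zero a).choose

lemma bdryHeight_pos (a : ℝ) : 0 < bdryHeight a := (exists_timeIm_zero a).choose_spec.1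

lemma bdryHeight_lt_pi (a : ℝ) : bdryHeight a < π := (exists_timeIm_zero a).choose_spec.2.1

lemma timeIm_bdryHeight (a : ℝ) : timeIm a (bdryHeight a) = 0 :=
  (exists_timeIm_zero a).choose_spec.2.2.1

lemma timeIm_pos {a b : ℝ} (h0 : 0 < b) (h : b < bdryHeight a) : 0 < timeIm a b :=
  (exists_timeIm_zero a).choose_spec.2.2.2.1 b h0 h

lemma timeIm_neg {a b : ℝ} (h : bdryHeight a < b) (hπ : b ≤ π) : timeIm a b < 0 :=
  (exists_timeIm_zero a).choose_spec.2.2.2.2.1 b h hπ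

lemma reSpeed_bdryHeight_neg (a : ℝ) : reSpeed a (bdryHeight a) < 0 :=
  (exists_timeIm_zero a).choose_spec.2.2.2.2.2.1

lemma reSpeed_neg_of_nonpos {a b : ℝ} (ha : a ≤ 0) (h0 : 0 < b) (h : b < bdryHeight a) :
    reSpeed a b < 0 :=
  (exists_timeIm_zero a).choose_spec.2.2.2.2.2.2 ha b h0 h

lemma eq_bdryHeight {a b : ℝ} (h0 : 0 < b) (hπ : b ≤ π) (h : timeIm a b = 0) :
    b = bdryHeight a := by
  rcases lt_trichotomy b (bdryHeight a) with hb | hb | hb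
  · exact absurd h (timeIm_pos h0 hb).ne'
  · exact hb
  · exact absurd h (timeIm_neg hb hπ).ne

lemma lt_bdryHeight {a b : ℝ} (hπ : b ≤ π) (h : 0 < timeIm a b) : b < bdryHeight a := by
  by_contra hle
  rcases (not_lt.1 hle).eq_or_lt with rfl | hlt
  · exact h.ne' (timeIm_bdryHeight a)
  · exact h.not_gt (timeIm_neg hlt hπ)

lemma bdryHeight_lt {a b : ℝ} (h0 : 0 < b) (h : timeIm a b < 0) : bdryHeight a < b := by
  by_contra hle
  rcases (not_lt.1 hle).eq_or_lt with rfl | hlt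
  · exact h.ne (timeIm_bdryHeight a)
  · exact h.not_gt (timeIm_pos h0 hlt)

lemma continuous_bdryHeight : Continuous bdryHeight := by
  have hc : ∀ a b, 0 < b → ContinuousAt (fun a => timeIm a b) a := by
    intro a b hb
    have h1 : ContinuousAt (fun a : ℝ => (a + b * I : ℂ)) a := by fun_prop
    exact Complex.continuous_im.continuousAt.comp
      (ContinuousAt.comp (g := timeFn) (continuousAt_timeFn (by simp [hb])) h1)
  refine continuous_iff_continuousAt.2 fun a => ?_
  rw [ContinuousAt, tendsto_order]
  constructor
  · intro c hcβ
    obtain ⟨d, h1, h2⟩ := exists_between (max_lt hcβ (bdryHeight_pos a))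
    have hd : 0 < d := (le_max_right _ _).trans_lt h1
    filter_upwards [(hc a d hd).eventually_const_lt (timeIm_pos hd h2)] with a' h
    exact ((le_max_left _ _).trans_lt h1).trans
      (lt_bdryHeight (h2.trans (bdryHeight_lt_pi a)).le h)
  · intro c hcβ
    obtain ⟨d, h1, h2⟩ := exists_between (lt_min hcβ (bdryHeight_lt_pi a))
    have hd : 0 < d := (bdryHeight_pos a).trans h1
    filter_upwards [(hc a d hd).eventually_lt_const
      (timeIm_neg h1 (h2.trans_le (min_le_right _ _)).le)] with a' h
    exact (bdryHeight_lt hd h).trans (h2.trans_le (min_le_left _ _))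

/-- The boundary curve approaches the negative real axis: there `timeIm a` starts from the value `π`
and decreases at a rate of order `e⁻ᵃ / |a|`. -/
lemma tendsto_bdryHeight_atBot : Tendsto bdryHeight atBot (𝓝 0) := by
  rw [tendsto_order]
  refine ⟨fun c hc => Eventually.of_forall fun a => hc.trans (bdryHeight_pos a), fun c hc => ?_⟩
  obtain ⟨ε, hε, hε'⟩ := exists_between (lt_min hc (by positivity : (0 : ℝ) < π / 2))
  have hεc := hε'.trans_le (min_le_left _ _)
  have hε2 := hε'.trans_le (min_le_right _ _)
  have hcos : 0 < Real.cos ε := cos_pos_of_mem_Ioo ⟨by linarith, hε2⟩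
  -- for `a ≤ -1` the mean value inequality gives `timeIm a ε ≤ π - ε * (e⁻ᵃ / (a² + π²)) * cos ε`
  have hlim : Tendsto (fun a : ℝ => Real.exp (-a) / (a ^ 2 + π ^ 2)) atBot atTop := by
    have h1 : Tendsto (fun y : ℝ => Real.exp y / y ^ 2) atTop atTop :=
      tendsto_exp_div_pow_atTop 2
    have h2 := (h1.comp tendsto_neg_atBot_atTop).atTop_mul_const (by norm_num : (0 : ℝ) < 1 / 17)
    refine tendsto_atTop_mono' _ ?_ h2
    filter_upwards [eventually_le_atBot (-1)] with a ha
    have hπ : π ^ 2 ≤ 16 * a ^ 2 := by nlinarith [pi_le_four, pi_pos]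
    have ha2 : 0 < a ^ 2 := by nlinarith
    simp only [Function.comp, neg_sq]
    rw [div_mul_div_comm, mul_one, mul_comm]
    gcongr
    linarith
  filter_upwards [hlim.eventually_gt_atTop (π / (Real.cos ε * ε)), eventually_le_atBot (-1)]
    with a ha ha1
  refine (bdryHeight_lt hε ?_).trans hεc
  have hd : ∀ b ∈ Icc 0 ε, HasDerivAt (timeIm a)
      (Real.exp (-a) / (a ^ 2 + b ^ 2) * reSpeed a b) b := fun b hb =>
    hasDerivAt_timeIm_vertical (Or.inr (by linarith))
  have hbound := (convex_Icc 0 ε).image_sub_le_mul_sub_of_deriv_le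
    (f := timeIm a) (C := -(Real.exp (-a) / (a ^ 2 + π ^ 2) * Real.cos ε))
    (fun b hb => (hd b hb).continuousAt.continuousWithinAt)
    (fun b hb => (hd b (interior_subset hb)).differentiableAt.differentiableWithinAt)
    (fun b hb => ?_) 0 (left_mem_Icc.2 hε.le) ε (right_mem_Icc.2 hε.le) hε.le
  · rw [timeIm_zero_of_neg (by linarith)] at hbound
    rw [div_lt_iff₀ (by positivity)] at ha
    linarith
  · rw [interior_Icc] at hb
    rw [(hd b ⟨hb.1.le, hb.2.le⟩).deriv]
    have h1 : Real.cos ε ≤ Real.cos b := cos_le_cos_of_nonneg_of_le_pi hb.1.le (by linarith) hb.2.le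
    have h2 : 0 < Real.sin b := sin_pos_of_pos_of_lt_pi hb.1 (by linarith [hb.2])
    have h3 : reSpeed a b ≤ -Real.cos ε := by
      rw [reSpeed]; nlinarith [mul_pos hb.1 h2]
    have h4 : Real.exp (-a) / (a ^ 2 + π ^ 2) ≤ Real.exp (-a) / (a ^ 2 + b ^ 2) := by
      have : b ≤ π := by linarith [hb.2]
      have := hb.1
      gcongr
    have h5 : 0 < Real.exp (-a) / (a ^ 2 + π ^ 2) := by positivity
    nlinarith

end TimeFunction

/-! ### The dynamics on the boundary curve -/

section Dynamics

open Real Complex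

/-- The vector field `x eˣ`. -/
noncomputable def xexp (z : ℂ) : ℂ := z * cexp z

lemma contDiff_xexp : ContDiff ℝ 1 xexp := contDiff_id.mul Complex.contDiff_exp

lemma xexp_conj (z : ℂ) : xexp (starRingEnd ℂ z) = starRingEnd ℂ (xexp z) := by
  simp [xexp, Complex.exp_conj]

lemma xexp_eq_zero_iff {z : ℂ} : xexp z = 0 ↔ z = 0 := by simp [xexp]

lemma xexp_re (z : ℂ) : (xexp z).re = Real.exp z.re * reSpeed z.re z.im := by
  simp [xexp, reSpeed, Complex.exp_re, Complex.exp_im]; ring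

/-- The boundary curve in the upper half-plane. -/
def upperCurve : Set ℂ := {z | z.im = bdryHeight z.re}

lemma im_pos_of_mem_upperCurve {z : ℂ} (hz : z ∈ upperCurve) : 0 < z.im :=
  (bdryHeight_pos _).trans_eq (Eq.symm hz)

lemma im_lt_pi_of_mem_upperCurve {z : ℂ} (hz : z ∈ upperCurve) : z.im < π :=
  (Eq.trans_lt hz (bdryHeight_lt_pi _))

lemma timeFn_im_of_mem_upperCurve {z : ℂ} (hz : z ∈ upperCurve) : (timeFn z).im = 0 := by
  rw [← timeIm_re_im, show z.im = _ from hz, timeIm_bdryHeight]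

lemma mem_upperCurve_of_timeFn_im {z : ℂ} (h0 : 0 < z.im) (hπ : z.im ≤ π)
    (h : (timeFn z).im = 0) : z ∈ upperCurve :=
  eq_bdryHeight h0 hπ (by rw [timeIm_re_im, h])

variable {J : Set ℝ} {γ : ℝ → ℂ}

lemma timeFn_comp_eq_add (hJ : IsOpen J) (hJ' : J.OrdConnected)
    (hγ : ∀ t ∈ J, HasDerivAt γ (xexp (γ t)) t) (him : ∀ t ∈ J, 0 < (γ t).im) {s t : ℝ}
    (hs : s ∈ J) (ht : t ∈ J) : timeFn (γ t) = timeFn (γ s) + ((t - s : ℝ) : ℂ) := by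
  have hd : ∀ r ∈ J, HasDerivAt (fun r : ℝ => timeFn (γ r) - r) 0 r := by
    intro r hr
    have hne : γ r ≠ 0 := fun h => by simpa [h] using him r hr
    have h1 := ((hasDerivAt_timeFn (Or.inl (him r hr))).comp r (hγ r hr)).sub
      (Complex.ofRealCLM.hasDerivAt (x := r))
    have h2 : cexp (-γ r) / γ r * xexp (γ r) - Complex.ofRealCLM 1 = 0 := by
      rw [xexp, Complex.exp_neg]
      field_simp
      simp
    rwa [h2] at h1
  have := hJ.is_const_of_deriv_eq_zero hJ'.isPreconnected
    (fun r hr => (hd r hr).differentiableAt.differentiableWithinAt)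
    (fun r hr => (hd r hr).deriv) hs ht
  push_cast
  linear_combination -this

/-- The boundary curve is invariant: the times at which a solution lies on it form a relatively
closed set, which is relatively open because `timeFn` has constant imaginary part along a
solution. -/
lemma mem_upperCurve_of_hasDerivAt (hJ : IsOpen J) (hJ' : J.OrdConnected)
    (hγ : ∀ t ∈ J, HasDerivAt γ (xexp (γ t)) t) {s t : ℝ} (hs : s ∈ J) (ht : t ∈ J)
    (h : γ s ∈ upperCurve) : γ t ∈ upperCurve := by
  have hopen : IsOpen {t | t ∈ J ∧ γ t ∈ upperCurve} := by
    rw [isOpen_iff_mem_nhds]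
    rintro r ⟨hr, hrc⟩
    have hc := Complex.continuous_im.continuousAt.comp (hγ r hr).continuousAt
    have hnear : ∀ᶠ u in 𝓝 r, u ∈ J ∧ 0 < (γ u).im ∧ (γ u).im < π :=
      Filter.Eventually.and (hJ.mem_nhds hr)
        ((hc.eventually_const_lt (im_pos_of_mem_upperCurve hrc)).and
          (hc.eventually_lt_const (im_lt_pi_of_mem_upperCurve hrc)))
    obtain ⟨ε, hε, hball⟩ := Metric.eventually_nhds_iff_ball.1 hnear
    filter_upwards [Metric.ball_mem_nhds r hε] with u hu
    obtain ⟨huJ, hu0, huπ⟩ := hball u hu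
    refine ⟨huJ, mem_upperCurve_of_timeFn_im hu0 huπ.le ?_⟩
    have := timeFn_comp_eq_add Metric.isOpen_ball
      (by rw [Real.ball_eq_Ioo]; exact ordConnected_Ioo) (fun v hv => hγ v (hball v hv).1)
      (fun v hv => (hball v hv).2.1) (Metric.mem_ball_self hε) hu
    rw [this, Complex.add_im, timeFn_im_of_mem_upperCurve hrc, Complex.ofReal_im, add_zero]
  have hopen' : IsOpen {t | t ∈ J ∧ γ t ∉ upperCurve} := by
    have hcl : IsClosed upperCurve :=
      isClosed_eq Complex.continuous_im (continuous_bdryHeight.comp Complex.continuous_re)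
    rw [isOpen_iff_mem_nhds]
    rintro r ⟨hr, hrc⟩
    exact Filter.Eventually.and (hJ.mem_nhds hr)
      ((hγ r hr).continuousAt (hcl.isOpen_compl.mem_nhds hrc))
  by_contra hne
  obtain ⟨r, -, h1, h2⟩ := hJ'.isPreconnected _ _ hopen hopen'
    (fun r hr => by by_cases h : γ r ∈ upperCurve <;> simp [hr, h]) ⟨s, hs, hs, h⟩ ⟨t, ht, ht, hne⟩
  exact h2.2 h1.2

lemma flow_mem_upperCurve {x : ℂ} (hx : x ∈ upperCurve) {t : ℝ} (ht : t ∈ maxInterval xexp x) :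
    flow xexp t x ∈ upperCurve :=
  mem_upperCurve_of_hasDerivAt isOpen_maxInterval ordConnected_maxInterval
    (fun _ hr => hasDerivAt_flow contDiff_xexp hr) (zero_mem_maxInterval contDiff_xexp x) ht
    (by rwa [flow_zero contDiff_xexp])

lemma timeFn_flow {x : ℂ} (hx : x ∈ upperCurve) {t : ℝ} (ht : t ∈ maxInterval xexp x) :
    timeFn (flow xexp t x) = timeFn x + t := by
  have := timeFn_comp_eq_add isOpen_maxInterval ordConnected_maxInterval
    (fun _ hr => hasDerivAt_flow contDiff_xexp hr)
    (fun _ hr => im_pos_of_mem_upperCurve (flow_mem_upperCurve hx hr))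
    (zero_mem_maxInterval contDiff_xexp x) ht
  rwa [flow_zero contDiff_xexp, sub_zero] at this

lemma hasDerivAt_flow_re {x : ℂ} {t : ℝ} (ht : t ∈ maxInterval xexp x) :
    HasDerivAt (fun t => (flow xexp t x).re)
      (Real.exp (flow xexp t x).re * reSpeed (flow xexp t x).re (flow xexp t x).im) t := by
  rw [← xexp_re]
  exact hasDerivAt_re_comp (hasDerivAt_flow contDiff_xexp ht)

lemma strictAntiOn_flow_re {x : ℂ} (hx : x ∈ upperCurve) :
    StrictAntiOn (fun t => (flow xexp t x).re) (maxInterval xexp x) := by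
  refine strictAntiOn_of_deriv_neg ordConnected_maxInterval.convex
    (fun t ht => (hasDerivAt_flow_re ht).continuousAt.continuousWithinAt) fun t ht => ?_
  have ht' := interior_subset ht
  rw [(hasDerivAt_flow_re ht').deriv]
  have h := flow_mem_upperCurve hx ht'
  rw [show (flow xexp t x).im = _ from h]
  exact mul_neg_of_pos_of_neg (Real.exp_pos _) (reSpeed_bdryHeight_neg _)

lemma norm_xexp_le {z : ℂ} {a : ℝ} (ha : z.re ≤ a) (h0 : 0 ≤ z.im) (hπ : z.im ≤ π) :
    ‖xexp z‖ ≤ (|a| + 1 + π) * Real.exp |a| := by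
  have h1 : ‖z‖ ≤ |z.re| + π :=
    (Complex.norm_le_abs_re_add_abs_im z).trans (by rw [abs_of_nonneg h0]; linarith)
  have h2 : ‖xexp z‖ ≤ (|z.re| + π) * Real.exp z.re := by
    rw [xexp, norm_mul, Complex.norm_exp]; gcongr
  refine h2.trans ?_
  have hpi := pi_pos
  rcases le_total z.re 0 with h | h
  · have h3 : -z.re * Real.exp z.re ≤ 1 := by
      have h4 : -z.re ≤ Real.exp (-z.re) := by linarith [Real.add_one_le_exp (-z.re)]
      calc -z.re * Real.exp z.re ≤ Real.exp (-z.re) * Real.exp z.re := by gcongr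
        _ = 1 := by rw [← Real.exp_add]; simp
    have h5 : Real.exp z.re ≤ 1 := Real.exp_le_one_iff.2 h
    have h6 : 1 ≤ Real.exp |a| := Real.one_le_exp (abs_nonneg a)
    rw [abs_of_nonpos h]
    nlinarith [abs_nonneg a]
  · have h7 : z.re ≤ |a| := ha.trans (le_abs_self a)
    rw [abs_of_nonneg h]
    have : z.re + π ≤ |a| + 1 + π := by linarith
    gcongr

/-- On the boundary curve the field is bounded to the left of any vertical line, so solutions exist
for all positive times. -/
lemma Ici_subset_maxInterval {x : ℂ} (hx : x ∈ upperCurve) : Ici 0 ⊆ maxInterval xexp x := by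
  intro τ hτ
  set C := (|x.re| + 1 + π) * Real.exp |x.re|
  have hC : 0 ≤ C := by have := pi_pos; positivity
  have h0 := zero_mem_maxInterval contDiff_xexp x
  refine mem_maxInterval_of_isCompact contDiff_xexp (isCompact_closedBall x (C * τ))
    fun t ht htτ => ?_
  rw [uIcc_of_le hτ] at htτ
  have hsub : Icc 0 t ⊆ maxInterval xexp x := ordConnected_maxInterval.out h0 ht
  have := (convex_Icc 0 t).norm_image_sub_le_of_norm_hasDerivWithin_le
    (f := fun t => flow xexp t x) (C := C)
    (fun r hr => (hasDerivAt_flow contDiff_xexp (hsub hr)).hasDerivWithinAt) (fun r hr => ?_)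
    (left_mem_Icc.2 htτ.1) (right_mem_Icc.2 htτ.1)
  · rw [mem_closedBall_iff_norm]
    rw [flow_zero contDiff_xexp, sub_zero, Real.norm_of_nonneg htτ.1] at this
    exact this.trans (by gcongr; exact htτ.2)
  · have h := flow_mem_upperCurve hx (hsub hr)
    refine norm_xexp_le ?_ (im_pos_of_mem_upperCurve h).le (im_lt_pi_of_mem_upperCurve h).le
    have := (strictAntiOn_flow_re hx).antitoneOn h0 (hsub hr) hr.1
    simpa [flow_zero contDiff_xexp] using this

lemma eq_of_mem_upperCurve {z : ℂ} (hz : z ∈ upperCurve) : z = z.re + bdryHeight z.re * I := by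
  rw [← show z.im = _ from hz, Complex.re_add_im]

lemma isCompact_curveSegment (A B : ℝ) : IsCompact {z ∈ upperCurve | z.re ∈ Icc A B} := by
  have : {z ∈ upperCurve | z.re ∈ Icc A B} =
      (fun a : ℝ => (a + bdryHeight a * I : ℂ)) '' Icc A B := by
    ext z
    constructor
    · rintro ⟨h1, h2⟩
      exact ⟨z.re, h2, (eq_of_mem_upperCurve h1).symm⟩
    · rintro ⟨a, ha, rfl⟩
      simpa [upperCurve] using ha
  rw [this]
  refine isCompact_Icc.image ?_
  have := continuous_bdryHeight
  fun_prop

lemma exists_abs_timeFn_re_le (A B : ℝ) :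
    ∃ C, ∀ z ∈ upperCurve, z.re ∈ Icc A B → |(timeFn z).re| ≤ C := by
  obtain ⟨C, hC⟩ := (isCompact_curveSegment A B).exists_bound_of_continuousOn
    (f := fun z => (timeFn z).re) fun z hz =>
      (Complex.continuous_re.continuousAt.comp (continuousAt_timeFn
        (Or.inl (im_pos_of_mem_upperCurve hz.1)))).continuousWithinAt
  exact ⟨C, fun z h1 h2 => hC z ⟨h1, h2⟩⟩

lemma timeFn_re_mono {a b : ℝ} (ha : 0 < a) (hab : a ≤ b) : (timeFn a).re ≤ (timeFn b).re := by
  have hd : ∀ c : ℝ, 0 < c →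
      HasDerivAt (fun c : ℝ => (timeFn c).re) (Real.exp (-c) / c) c := by
    intro c hc
    have h := hasDerivAt_re_comp
      (hasDerivAt_timeFn (z := (c : ℂ)) (Or.inr (by simpa using hc.ne'))).comp_ofReal
    rwa [show cexp (-c) / c = ((Real.exp (-c) / c : ℝ) : ℂ) by push_cast; rfl,
      Complex.ofReal_re] at h
  refine monotoneOn_of_deriv_nonneg (convex_Ioi 0)
    (fun c hc => (hd c hc).continuousAt.continuousWithinAt)
    (fun c hc => (hd c (interior_subset hc)).differentiableAt.differentiableWithinAt)
    (fun c hc => ?_) (mem_Ioi.2 ha) (mem_Ioi.2 (ha.trans_le hab)) hab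
  have hc0 : 0 < c := interior_subset hc
  rw [(hd c hc0).deriv]
  positivity

/-- On the part of the boundary curve to the right of a vertical line the real time is bounded
below. -/
lemma exists_le_timeFn_re (A : ℝ) : ∃ C, ∀ z ∈ upperCurve, A ≤ z.re → C ≤ (timeFn z).re := by
  obtain ⟨C, hC⟩ := exists_abs_timeFn_re_le A 1
  refine ⟨min (-C) ((timeFn (1 : ℝ)).re - π), fun z hz hA => ?_⟩
  rcases le_total z.re 1 with h | h
  · exact (min_le_left _ _).trans (abs_le.1 (hC z hz ⟨hA, h⟩)).1
  · refine (min_le_right _ _).trans ?_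
    have h0 : 0 < z.re := by linarith
    have h1 := timeFn_re_mono one_pos h
    have h2 := (Complex.abs_re_le_norm _).trans
      (norm_timeFn_sub_le h0 (im_pos_of_mem_upperCurve hz).le)
    rw [Complex.re_add_im, Complex.sub_re] at h2
    have h3 : Real.exp (-z.re) / z.re * z.im ≤ 1 / 1 * π := by
      have h4 : Real.exp (-z.re) ≤ 1 := Real.exp_le_one_iff.2 (by linarith)
      have h5 := (im_lt_pi_of_mem_upperCurve hz).le
      have h6 := (im_pos_of_mem_upperCurve hz).le
      gcongr
    have := (abs_le.1 h2).1
    linarith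

lemma tendsto_flow_re_atTop {x : ℂ} (hx : x ∈ upperCurve) :
    Tendsto (fun t => (flow xexp t x).re) atTop atBot := by
  have hI := Ici_subset_maxInterval hx
  rw [tendsto_atBot]
  intro A
  obtain ⟨C, hC⟩ := exists_abs_timeFn_re_le A x.re
  filter_upwards [eventually_gt_atTop (C - (timeFn x).re), eventually_ge_atTop 0] with t ht ht0
  by_contra hlt
  have hle := (strictAntiOn_flow_re hx).antitoneOn (hI self_mem_Ici) (hI ht0) ht0
  simp only [flow_zero contDiff_xexp] at hle
  have h1 := hC _ (flow_mem_upperCurve hx (hI ht0)) ⟨(not_le.1 hlt).le, hle⟩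
  rw [timeFn_flow hx (hI ht0), Complex.add_re, Complex.ofReal_re] at h1
  linarith [le_abs_self ((timeFn x).re + t)]

/-- The behaviour of a solution that comes from `+∞` at a finite time, moves to the left
all the time and exists for all positive times, while it approaches the negative real axis. -/
structure IsLeftwardSolution (x : ℂ) (T : ℝ) : Prop where
  neg : T < 0
  maxInterval_eq : maxInterval xexp x = Ioi T
  tendsto_re_start : Tendsto (fun t => (flow xexp t x).re) (𝓝[>] T) atTop
  tendsto_re_atTop : Tendsto (fun t => (flow xexp t x).re) atTop atBot
  tendsto_im_atTop : Tendsto (fun t => (flow xexp t x).im) atTop (𝓝 0)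
  strictAntiOn : StrictAntiOn (fun t => (flow xexp t x).re) (Ioi T)
  ne_zero : ∀ t ∈ Ioi T, flow xexp t x ≠ 0

lemma exists_isLeftwardSolution {x : ℂ} (hx : x ∈ upperCurve) : ∃ T, IsLeftwardSolution x T := by
  have hI := Ici_subset_maxInterval hx
  have h0 := zero_mem_maxInterval contDiff_xexp x
  have hanti := strictAntiOn_flow_re hx
  have hre : ∀ t ∈ maxInterval xexp x, t ≤ 0 → x.re ≤ (flow xexp t x).re := by
    intro t ht ht0
    have := hanti.antitoneOn ht h0 ht0
    simpa [flow_zero contDiff_xexp] using this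
  obtain ⟨C, hC⟩ := exists_le_timeFn_re x.re
  have hbdd : BddBelow (maxInterval xexp x) := by
    refine ⟨min 0 (C - (timeFn x).re), fun t ht => ?_⟩
    rcases le_total t 0 with h | h
    · have h1 := hC _ (flow_mem_upperCurve hx ht) (hre t ht h)
      rw [timeFn_flow hx ht, Complex.add_re, Complex.ofReal_re] at h1
      exact (min_le_right _ _).trans (by linarith)
    · exact (min_le_left _ _).trans h
  set T := sInf (maxInterval xexp x) with hT
  have hTn : T ∉ maxInterval xexp x := by
    intro hmem
    obtain ⟨t, ht, htT⟩ := (Filter.Eventually.and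
      (nhdsWithin_le_nhds (s := Iio T) (isOpen_maxInterval.mem_nhds hmem))
      self_mem_nhdsWithin).exists
    exact (csInf_le hbdd ht).not_gt htT
  have hT0 : T < 0 := (csInf_le hbdd h0).lt_of_ne fun h => hTn (by rwa [hT, h])
  have hIoi : maxInterval xexp x = Ioi T := by
    refine Subset.antisymm
      (fun t ht => (csInf_le hbdd ht).lt_of_ne fun h => hTn (by rwa [hT, h])) ?_
    intro t ht
    obtain ⟨s, hs, hst⟩ := exists_lt_of_csInf_lt ⟨0, h0⟩
      (show sInf (maxInterval xexp x) < t from ht)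
    exact ordConnected_maxInterval.out hs (hI (le_max_right t 0)) ⟨hst.le, le_max_left _ _⟩
  refine ⟨T, hT0, hIoi, ?_, tendsto_flow_re_atTop hx, ?_, hIoi ▸ hanti, fun t ht h => ?_⟩
  · rw [tendsto_atTop]
    intro B
    -- a solution with bounded real part would extend to the time `T`
    have : ∃ t ∈ maxInterval xexp x, t ≤ 0 ∧ B < (flow xexp t x).re := by
      by_contra! hcon
      refine hTn (mem_maxInterval_of_isCompact contDiff_xexp
        (isCompact_curveSegment x.re B) fun t ht htT => ?_)
      rw [uIcc_of_ge hT0.le] at htT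
      exact ⟨flow_mem_upperCurve hx ht, hre t ht htT.2, hcon t ht htT.2⟩
    obtain ⟨t, ht, -, hB⟩ := this
    have htT : T < t := by rw [hIoi] at ht; exact ht
    filter_upwards [Ioo_mem_nhdsGT htT] with s hs
    exact (hB.trans (hanti (by rw [hIoi]; exact hs.1) ht hs.2)).le
  · have h1 := tendsto_bdryHeight_atBot.comp (tendsto_flow_re_atTop hx)
    refine h1.congr' ?_
    filter_upwards [eventually_ge_atTop 0] with t ht
    exact (flow_mem_upperCurve hx (hI ht)).symm
  · have := im_pos_of_mem_upperCurve (flow_mem_upperCurve hx (hIoi ▸ ht))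
    rw [h] at this
    simp at this

/-- The boundary curve is a single orbit, since the real part of a solution on it takes all real
values. -/
lemma orbit_eq_upperCurve {x : ℂ} (hx : x ∈ upperCurve) : orbit xexp x = upperCurve := by
  obtain ⟨T, h⟩ := exists_isLeftwardSolution hx
  refine Subset.antisymm ?_ fun z hz => ?_
  · rintro _ ⟨t, ht, rfl⟩
    exact flow_mem_upperCurve hx ht
  · obtain ⟨s, hs1, hs2⟩ := ((h.tendsto_re_atTop.eventually_le_atBot z.re).and
      (eventually_gt_atTop T)).exists
    obtain ⟨u, hu1, hu2⟩ := ((h.tendsto_re_start.eventually_ge_atTop z.re).and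
      self_mem_nhdsWithin).exists
    have hc : ContinuousOn (fun t => (flow xexp t x).re) (maxInterval xexp x) :=
      fun t ht => (hasDerivAt_flow_re ht).continuousAt.continuousWithinAt
    obtain ⟨t, ht, hte⟩ := ordConnected_maxInterval.isPreconnected.intermediate_value
      (h.maxInterval_eq ▸ hs2) (h.maxInterval_eq ▸ hu2) hc ⟨hs1, hu1⟩
    refine ⟨t, ht, ?_⟩
    change flow xexp t x = z
    rw [eq_of_mem_upperCurve hz, eq_of_mem_upperCurve (flow_mem_upperCurve hx ht)]
    simp only at hte
    simp [hte]

namespace IsLeftwardSolution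

variable {x : ℂ} {T : ℝ}

lemma conj (h : IsLeftwardSolution x T) : IsLeftwardSolution (starRingEnd ℂ x) T := by
  have hflow : ∀ t ∈ Ioi T, flow xexp t (starRingEnd ℂ x) = starRingEnd ℂ (flow xexp t x) :=
    fun t ht => flow_conj contDiff_xexp xexp_conj (h.maxInterval_eq ▸ ht)
  have hre : EqOn (fun t => (flow xexp t x).re) (fun t => (flow xexp t (starRingEnd ℂ x)).re)
      (Ioi T) := fun t ht => by simp [hflow t ht]
  refine ⟨h.neg, (maxInterval_conj xexp_conj x).trans h.maxInterval_eq, ?_, ?_, ?_, ?_, ?_⟩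
  · exact h.tendsto_re_start.congr' (hre.eventuallyEq_of_mem self_mem_nhdsWithin)
  · exact h.tendsto_re_atTop.congr' (hre.eventuallyEq_of_mem (Ioi_mem_atTop T))
  · have h1 := h.tendsto_im_atTop.neg
    rw [neg_zero] at h1
    refine h1.congr' ?_
    filter_upwards [Ioi_mem_atTop T] with t ht
    simp [hflow t ht]
  · exact h.strictAntiOn.congr hre
  · intro t ht
    rw [hflow t ht]
    simpa using h.ne_zero t ht

lemma hasNegativeBlowUp (h : IsLeftwardSolution x T) : HasNegativeBlowUp xexp x := by
  refine ⟨T, h.neg, by rw [h.maxInterval_eq, Ioi_inter_Iic], ?_⟩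
  rw [← tendsto_norm_atTop_iff_cobounded]
  exact tendsto_atTop_mono (fun t => (le_abs_self _).trans (Complex.abs_re_le_norm _))
    h.tendsto_re_start

lemma isNegativeSeparatrix (h : IsLeftwardSolution x T) :
    IsNegativeSeparatrix xexp (orbit xexp x) := by
  refine ⟨x, rfl, ?_⟩
  rw [h.maxInterval_eq, Ioi_inter_Iic]
  exact Metric.isBounded_Ioc T 0

lemma not_isBounded (h : IsLeftwardSolution x T) :
    ¬ Bornology.IsBounded (maxInterval xexp x ∩ Ici 0) := by
  have : maxInterval xexp x ∩ Ici 0 = Ici 0 := by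
    rw [h.maxInterval_eq]
    exact inter_eq_right.2 fun t ht => h.neg.trans_le ht
  rw [this]
  exact fun hb => not_bddAbove_Ici (0 : ℝ) hb.bddAbove

lemma not_hasPositiveBlowUp (h : IsLeftwardSolution x T) : ¬ HasPositiveBlowUp xexp x := by
  rintro ⟨S, -, hS, -⟩
  exact h.not_isBounded (hS ▸ Metric.isBounded_Ico 0 S)

lemma timeFromTo_flow (h : IsLeftwardSolution x T) {t : ℝ} (ht : t ∈ Ioi T) :
    timeFromTo xexp x (flow xexp t x) = t := by
  have hex : ∃ s, s ∈ maxInterval xexp x ∧ flow xexp s x = flow xexp t x :=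
    ⟨t, h.maxInterval_eq ▸ ht, rfl⟩
  obtain ⟨h1, h2⟩ := Classical.epsilon_spec hex
  exact h.strictAntiOn.injOn (h.maxInterval_eq.subset h1) ht (congrArg Complex.re h2)

/-- The integrand of the transit time, parametrized by the flow, is constantly `1`. -/
lemma transitTime_flow (h : IsLeftwardSolution x T) {t : ℝ} (ht : t ∈ Ioi T) :
    transitTime xexp x (flow xexp t x) = t := by
  rw [transitTime, h.timeFromTo_flow ht]
  have : ∀ s ∈ uIcc 0 t, (1 / xexp (flow xexp s x)) *
      deriv (fun r => flow xexp r x) s = 1 := by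
    intro s hs
    have hs' : s ∈ Ioi T := ordConnected_Ioi.uIcc_subset h.neg ht hs
    rw [(hasDerivAt_flow contDiff_xexp (h.maxInterval_eq ▸ hs')).deriv, one_div,
      inv_mul_cancel₀ (xexp_eq_zero_iff.not.2 (h.ne_zero s hs'))]
  rw [intervalIntegral.integral_congr this]
  simp

lemma exists_lt_transitTime (h : IsLeftwardSolution x T) (M : ℝ) :
    ∃ R : ℝ, ∀ y ∈ posOrbit xexp x, y.re < R → M < transitTime xexp x y := by
  refine ⟨(flow xexp (max M 0) x).re, ?_⟩
  rintro _ ⟨t, ⟨ht, -⟩, rfl⟩ hlt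
  rw [h.maxInterval_eq] at ht
  rw [h.transitTime_flow ht]
  have := (h.strictAntiOn.lt_iff_gt ht (h.neg.trans_le (le_max_right M 0))).1 hlt
  exact (le_max_left _ _).trans_lt this

lemma not_bddAbove_transitTime (h : IsLeftwardSolution x T) :
    ¬ BddAbove (transitTime xexp x '' posOrbit xexp x) := by
  rintro ⟨M, hM⟩
  have hpos : (0 : ℝ) ≤ max M 0 + 1 := by positivity
  have hmem : max M 0 + 1 ∈ Ioi T := h.neg.trans_le hpos
  have := hM ⟨_, ⟨_, ⟨h.maxInterval_eq ▸ hmem, hpos⟩, rfl⟩, rfl⟩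
  simp only at this
  rw [h.transitTime_flow hmem] at this
  linarith [le_max_left M 0]

end IsLeftwardSolution

end Dynamics

/-! ### The basin of the origin and its frontier -/

section Basin

open Real Complex

/-- The region between the boundary curve and its complex conjugate. -/
def innerRegion : Set ℂ := {z | |z.im| < bdryHeight z.re}

lemma isOpen_innerRegion : IsOpen innerRegion :=
  isOpen_lt (by fun_prop) (continuous_bdryHeight.comp Complex.continuous_re)

lemma zero_mem_innerRegion : (0 : ℂ) ∈ innerRegion := by simp [innerRegion, bdryHeight_pos]

lemma conj_mem_upperCurve_iff {z : ℂ} :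
    starRingEnd ℂ z ∈ upperCurve ↔ -z.im = bdryHeight z.re := by simp [upperCurve]

lemma abs_im_eq_bdryHeight_iff {z : ℂ} :
    |z.im| = bdryHeight z.re ↔ z ∈ upperCurve ∨ starRingEnd ℂ z ∈ upperCurve := by
  rw [conj_mem_upperCurve_iff, abs_eq (bdryHeight_pos _).le, neg_eq_iff_eq_neg]
  rfl

lemma frontier_innerRegion : frontier innerRegion = {z | |z.im| = bdryHeight z.re} := by
  have hc := continuous_bdryHeight
  refine Subset.antisymm (frontier_lt_subset_eq (by fun_prop) (by fun_prop)) fun z hz => ?_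
  have hz' : |z.im| = bdryHeight z.re := hz
  rw [frontier, isOpen_innerRegion.interior_eq]
  refine ⟨?_, fun h => (show |z.im| < bdryHeight z.re from h).ne hz'⟩
  -- `z` is the limit of the points below it, with the imaginary part scaled by `r < 1`
  have h1 : Tendsto (fun r : ℝ => (z.re + (r * z.im : ℝ) * I : ℂ)) (𝓝[<] 1) (𝓝 z) := by
    have h2 : Continuous fun r : ℝ => (z.re + (r * z.im : ℝ) * I : ℂ) := by fun_prop
    have h3 := h2.tendsto 1
    simp only [one_mul, Complex.re_add_im] at h3
    exact h3.mono_left nhdsWithin_le_nhds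
  refine mem_closure_of_tendsto h1 ?_
  filter_upwards [Ioo_mem_nhdsLT (zero_lt_one (α := ℝ))] with r hr
  have hb := bdryHeight_pos z.re
  simp only [innerRegion, mem_ofPred_eq, add_re, ofReal_re, mul_re, I_re, mul_zero, ofReal_im, I_im,
    mul_one, sub_self, add_zero, add_im, mul_im, zero_add, abs_mul, abs_of_pos hr.1, hz']
  exact mul_lt_of_lt_one_left hb hr.2

variable {J : Set ℝ} {γ : ℝ → ℂ}

lemma hasDerivAt_conj_comp {t : ℝ} (h : HasDerivAt γ (xexp (γ t)) t) :
    HasDerivAt (fun t => starRingEnd ℂ (γ t)) (xexp (starRingEnd ℂ (γ t))) t := by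
  rw [xexp_conj]
  exact hasDerivAt_conj h

lemma im_eq_zero_of_hasDerivAt (hJ : IsOpen J) (hJ' : J.OrdConnected)
    (hγ : ∀ t ∈ J, HasDerivAt γ (xexp (γ t)) t) {s t : ℝ} (hs : s ∈ J) (ht : t ∈ J)
    (h : (γ s).im = 0) : (γ t).im = 0 :=
  Complex.conj_eq_iff_im.1 (eqOn_of_hasDerivAt_of_contDiff contDiff_xexp hJ hJ'
    (fun r hr => hasDerivAt_conj_comp (hγ r hr)) hγ hs (Complex.conj_eq_iff_im.2 h) ht)

/-- The region is invariant, since solutions cannot cross its frontier. -/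
lemma mem_innerRegion_of_hasDerivAt (hJ : IsOpen J) (hJ' : J.OrdConnected)
    (hγ : ∀ t ∈ J, HasDerivAt γ (xexp (γ t)) t) {s t : ℝ} (hs : s ∈ J) (ht : t ∈ J)
    (h : γ s ∈ innerRegion) : γ t ∈ innerRegion := by
  have hc : ContinuousOn γ J := fun r hr => (hγ r hr).continuousAt.continuousWithinAt
  have hb := continuous_bdryHeight
  have hq : Continuous fun z : ℂ => bdryHeight z.re - |z.im| := by fun_prop
  refine sub_pos.1 (hJ'.isPreconnected.pos_of_ne_zero
    (q := fun t => bdryHeight (γ t).re - |(γ t).im|) (hq.comp_continuousOn hc)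
    (fun r hr h0 => ?_) hs (sub_pos.2 h) ht)
  have h1 : |(γ s).im| = bdryHeight (γ s).re := by
    rw [abs_im_eq_bdryHeight_iff]
    refine (abs_im_eq_bdryHeight_iff.1 (sub_eq_zero.1 h0).symm).imp
      (fun h => mem_upperCurve_of_hasDerivAt hJ hJ' hγ hr hs h) fun h => ?_
    exact mem_upperCurve_of_hasDerivAt hJ hJ' (γ := fun t => starRingEnd ℂ (γ t))
      (fun r hr => hasDerivAt_conj_comp (hγ r hr)) hr hs h
  exact (show |(γ s).im| < _ from h).ne h1

/-- The entire function `z exp (E z)`, where `E` is `expPrimitive`, linearizes the flow. -/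
noncomputable def linearizer (z : ℂ) : ℂ := z * cexp (expPrimitive z)

lemma hasDerivAt_linearizer (z : ℂ) :
    HasDerivAt linearizer (cexp (expPrimitive z) * cexp (-z)) z := by
  have h := (hasDerivAt_id z).mul (hasDerivAt_expPrimitive' z).cexp
  convert! h using 1
  rcases eq_or_ne z 0 with rfl | hz
  · simp
  · rw [dslope_of_ne _ hz, slope_def_field]
    simp
    field_simp
    ring

lemma linearizer_flow {x : ℂ} {t : ℝ} (ht : t ∈ maxInterval xexp x) :
    linearizer (flow xexp t x) = Real.exp t * linearizer x := by
  have hd : ∀ r ∈ maxInterval xexp x,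
      HasDerivAt (fun r : ℝ => (Real.exp (-r) : ℂ) * linearizer (flow xexp r x)) 0 r := by
    intro r hr
    have h1 : HasDerivAt (fun r : ℝ => (Real.exp (-r) : ℂ)) (-Real.exp (-r) : ℂ) r := by
      have := (hasDerivAt_neg r).exp.ofReal_comp
      simpa using this
    have h2 := h1.mul ((hasDerivAt_linearizer _).comp r (hasDerivAt_flow contDiff_xexp hr))
    convert! h2 using 1
    simp only [linearizer, xexp, Function.comp, Complex.exp_neg (flow xexp r x)]
    field_simp
    ring
  have := isOpen_maxInterval.is_const_of_deriv_eq_zero ordConnected_maxInterval.isPreconnected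
    (fun r hr => (hd r hr).differentiableAt.differentiableWithinAt)
    (fun r hr => (hd r hr).deriv) ht (zero_mem_maxInterval contDiff_xexp x)
  simp only [neg_zero, Real.exp_zero, ofReal_one, one_mul, flow_zero contDiff_xexp] at this
  rw [← this, ← mul_assoc, ← ofReal_mul, ← Real.exp_add]
  simp

/-- A solution that stays in a compact set for negative times tends to `0` as `t → -∞`. -/
lemma tendsto_flow_atBot {x : ℂ} {K : Set ℂ} (hK : IsCompact K)
    (h : ∀ t ∈ maxInterval xexp x, t ≤ 0 → flow xexp t x ∈ K) :
    Iic 0 ⊆ maxInterval xexp x ∧ Tendsto (fun t => flow xexp t x) atBot (𝓝 0) := by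
  have hI : Iic 0 ⊆ maxInterval xexp x := fun τ hτ =>
    mem_maxInterval_of_isCompact contDiff_xexp hK fun t ht htτ =>
      h t ht (by rw [uIcc_of_ge hτ] at htτ; exact htτ.2)
  refine ⟨hI, ?_⟩
  obtain ⟨C, hC⟩ := hK.exists_bound_of_continuousOn (f := fun z => cexp (-expPrimitive z))
    (by have := differentiable_expPrimitive.continuous; fun_prop)
  have h0 : Tendsto (fun t : ℝ => Real.exp t * ‖linearizer x‖ * C) atBot (𝓝 0) := by
    simpa using (Real.tendsto_exp_atBot.mul_const ‖linearizer x‖).mul_const C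
  refine squeeze_zero_norm' ?_ h0
  filter_upwards [eventually_le_atBot 0] with t ht
  have h1 : flow xexp t x = linearizer (flow xexp t x) * cexp (-expPrimitive (flow xexp t x)) := by
    rw [linearizer, mul_assoc, ← Complex.exp_add]; simp
  rw [h1, linearizer_flow (hI ht), norm_mul, norm_mul, Complex.norm_real,
    Real.norm_of_nonneg (Real.exp_pos t).le]
  gcongr
  exact hC _ (h t (hI ht) ht)

lemma exists_isCompact_of_im_eq_zero {x : ℂ} (hx : x.im = 0) :
    ∃ K : Set ℂ, IsCompact K ∧ ∀ t ∈ maxInterval xexp x, t ≤ 0 → flow xexp t x ∈ K := by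
  have h0 := zero_mem_maxInterval contDiff_xexp x
  have him : ∀ t ∈ maxInterval xexp x, (flow xexp t x).im = 0 := fun t ht =>
    im_eq_zero_of_hasDerivAt isOpen_maxInterval ordConnected_maxInterval
      (fun r hr => hasDerivAt_flow contDiff_xexp hr) h0 ht (by rwa [flow_zero contDiff_xexp])
  refine ⟨_, isCompact_closedBall 0 ‖x‖, fun t ht ht0 => ?_⟩
  -- the square of the real part is nondecreasing
  have hd : ∀ t ∈ maxInterval xexp x, HasDerivAt (fun t => (flow xexp t x).re ^ 2)
      (2 * Real.exp (flow xexp t x).re * (flow xexp t x).re ^ 2) t := by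
    intro t ht
    have := (hasDerivAt_flow_re ht).pow 2
    rw [him t ht] at this
    convert! this using 1
    simp [reSpeed]
    ring
  have hm := monotoneOn_of_deriv_nonneg (ordConnected_maxInterval (F := xexp) (x := x)).convex
    (fun t ht => (hd t ht).continuousAt.continuousWithinAt)
    (fun t ht => (hd t (interior_subset ht)).differentiableAt.differentiableWithinAt)
    (fun t ht => by rw [(hd t (interior_subset ht)).deriv]; positivity) ht h0 ht0
  simp only [flow_zero contDiff_xexp] at hm
  have hnorm : ∀ z : ℂ, z.im = 0 → ‖z‖ = |z.re| := fun z hz => by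
    conv_lhs => rw [← Complex.re_add_im z, hz]
    simp
  rw [mem_closedBall_zero_iff, hnorm _ (him t ht), hnorm _ hx]
  exact sq_le_sq.1 hm

lemma exists_isCompact_of_im_pos {x : ℂ} (hx : x ∈ innerRegion) (hx0 : 0 < x.im) :
    ∃ K : Set ℂ, IsCompact K ∧ ∀ t ∈ maxInterval xexp x, t ≤ 0 → flow xexp t x ∈ K := by
  have h0 := zero_mem_maxInterval contDiff_xexp x
  have hγ : ∀ t ∈ maxInterval xexp x, HasDerivAt (fun t => flow xexp t x) _ t :=
    fun r hr => hasDerivAt_flow contDiff_xexp hr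
  have hpos : ∀ t ∈ maxInterval xexp x, 0 < (flow xexp t x).im := fun t ht =>
    ordConnected_maxInterval.isPreconnected.pos_of_ne_zero
      (Complex.continuous_im.comp_continuousOn (continuousOn_flow contDiff_xexp x))
      (fun r hr h => by
        have := im_eq_zero_of_hasDerivAt isOpen_maxInterval ordConnected_maxInterval hγ hr h0 h
        simp only [flow_zero contDiff_xexp] at this
        exact hx0.ne' this) h0 (by simpa [flow_zero contDiff_xexp] using hx0) ht
  have hlt : ∀ t ∈ maxInterval xexp x, (flow xexp t x).im < bdryHeight (flow xexp t x).re := by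
    intro t ht
    have := mem_innerRegion_of_hasDerivAt isOpen_maxInterval ordConnected_maxInterval hγ h0 ht
      (by simpa [flow_zero contDiff_xexp] using hx)
    exact (le_abs_self _).trans_lt this
  have hconst : ∀ t ∈ maxInterval xexp x,
      timeIm (flow xexp t x).re (flow xexp t x).im = timeIm x.re x.im := by
    intro t ht
    have := timeFn_comp_eq_add isOpen_maxInterval ordConnected_maxInterval hγ hpos h0 ht
    rw [timeIm_re_im, timeIm_re_im, this, flow_zero contDiff_xexp]
    simp
  set c := timeIm x.re x.im
  have hc : 0 < c := timeIm_pos hx0 ((le_abs_self _).trans_lt hx)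
  refine ⟨Icc (min x.re 0) (π / c) ×ℂ Icc 0 π, isCompact_Icc.reProdIm isCompact_Icc,
    fun t ht ht0 => ⟨⟨?_, ?_⟩, (hpos t ht).le, ((hlt t ht).trans (bdryHeight_lt_pi _)).le⟩⟩
  · -- at times when the real part is negative it decreases
    by_contra hcon
    rw [not_le, lt_min_iff] at hcon
    have hsub : Icc t 0 ⊆ maxInterval xexp x := ordConnected_maxInterval.out ht h0
    have := image_le_of_deriv_right_lt_deriv_boundary' (a := t) (b := 0)
      (f := fun t => (flow xexp t x).re) (B := fun _ => (flow xexp t x).re) (B' := fun _ => 0)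
      (fun r hr => (hasDerivAt_flow_re (hsub hr)).continuousAt.continuousWithinAt)
      (fun r hr => (hasDerivAt_flow_re (hsub (Ico_subset_Icc_self hr))).hasDerivWithinAt) le_rfl
      continuousOn_const (fun r _ => hasDerivWithinAt_const _ _ _)
      (fun r hr he => by
        have hr' := hsub (Ico_subset_Icc_self hr)
        refine mul_neg_of_pos_of_neg (Real.exp_pos _) ?_
        exact reSpeed_neg_of_nonpos (he.trans_lt hcon.2).le (hpos r hr') (hlt r hr'))
      (right_mem_Icc.2 ht0)
    simp only [flow_zero contDiff_xexp] at this
    exact hcon.1.not_ge this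
  · -- far to the right `timeIm` is less than its value `c` on the orbit
    set a := (flow xexp t x).re with ha
    rcases le_or_gt a 0 with h | h
    · exact h.trans (by have := pi_pos; positivity)
    · have h1 := (le_abs_self _).trans (abs_timeIm_le h (hpos t ht).le)
      rw [hconst t ht] at h1
      have h2 : Real.exp (-a) / a * (flow xexp t x).im ≤ 1 / a * π := by
        have h3 : Real.exp (-a) ≤ 1 := Real.exp_le_one_iff.2 (by linarith)
        have h4 := ((hlt t ht).trans (bdryHeight_lt_pi _)).le
        have h5 := (hpos t ht).le
        gcongr
      rw [le_div_iff₀ hc]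
      have h6 : c ≤ 1 / a * π := h1.trans h2
      calc a * c ≤ a * (1 / a * π) := by gcongr
        _ = π := by field_simp

lemma tendsto_flow_atBot_of_mem_innerRegion {x : ℂ} (hx : x ∈ innerRegion) :
    Iic 0 ⊆ maxInterval xexp x ∧ Tendsto (fun t => flow xexp t x) atBot (𝓝 0) := by
  suffices ∃ K : Set ℂ, IsCompact K ∧ ∀ t ∈ maxInterval xexp x, t ≤ 0 → flow xexp t x ∈ K by
    obtain ⟨K, hK, h⟩ := this
    exact tendsto_flow_atBot hK h
  rcases lt_trichotomy x.im 0 with h | h | h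
  · obtain ⟨K, hK, hsub⟩ := exists_isCompact_of_im_pos (x := starRingEnd ℂ x)
      (by simpa [innerRegion] using hx) (by simpa using h)
    refine ⟨_, hK.image Complex.continuous_conj, fun t ht ht0 => ⟨_, hsub t ?_ ht0, ?_⟩⟩
    · rwa [maxInterval_conj xexp_conj]
    · rw [flow_conj contDiff_xexp xexp_conj ht, Complex.conj_conj]
  · exact exists_isCompact_of_im_eq_zero h
  · exact exists_isCompact_of_im_pos hx h

lemma repulsionBasin_eq_innerRegion : repulsionBasin xexp 0 = innerRegion := by
  ext x
  constructor
  · intro hx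
    obtain ⟨t, ht, -, hlim⟩ : (0 : ℂ) ∈ negLimitSet xexp x := by
      rw [show negLimitSet xexp x = {0} from hx]; rfl
    obtain ⟨k, hk⟩ :=
      (hlim.eventually_mem (isOpen_innerRegion.mem_nhds zero_mem_innerRegion)).exists
    have := mem_innerRegion_of_hasDerivAt isOpen_maxInterval ordConnected_maxInterval
      (fun r hr => hasDerivAt_flow contDiff_xexp hr) (ht k)
      (zero_mem_maxInterval contDiff_xexp x) hk
    rwa [flow_zero contDiff_xexp] at this
  · intro hx
    obtain ⟨hI, hlim⟩ := tendsto_flow_atBot_of_mem_innerRegion hx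
    refine Subset.antisymm ?_ ?_
    · rintro v ⟨t, -, ht, hv⟩
      exact tendsto_nhds_unique hv (hlim.comp ht)
    · rintro _ rfl
      have hneg : Tendsto (fun k : ℕ => -(k : ℝ)) atTop atBot :=
        tendsto_neg_atTop_atBot.comp tendsto_natCast_atTop_atTop
      exact ⟨fun k => -(k : ℝ), fun k => hI (by simp), hneg, hlim.comp hneg⟩

/-- As `linearizer` multiplies by the real factor `eᵗ` along a solution, its argument is constant.
Hence the polar angle at time `t` is a constant minus `Im E (Φ(t, x))`, where `E` is
`expPrimitive`, and it converges because `Φ(t, x) → 0`. -/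
lemma isUnstableNode_xexp : IsUnstableNode xexp 0 := by
  refine ⟨by simp [xexp], ?_⟩
  obtain ⟨δ, hδ, hball⟩ := Metric.isOpen_iff.1 isOpen_innerRegion 0 zero_mem_innerRegion
  refine ⟨δ, hδ, fun x _ hx => ?_⟩
  obtain ⟨hI, hlim⟩ := tendsto_flow_atBot_of_mem_innerRegion (hball (mem_ball_iff_norm.2 hx))
  have hE := differentiable_expPrimitive.continuous
  refine ⟨hI, hlim, fun t => (linearizer x).arg - (expPrimitive (flow xexp t x)).im,
    ⟨?_, fun t ht => ?_⟩, (linearizer x).arg - (expPrimitive 0).im, ?_⟩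
  · have := (continuousOn_flow contDiff_xexp x).mono hI
    fun_prop
  · have h1 : flow xexp t x = Real.exp t * linearizer x * cexp (-expPrimitive (flow xexp t x)) := by
      rw [← linearizer_flow (hI ht), linearizer, mul_assoc, ← Complex.exp_add]; simp
    have h2 : ‖flow xexp t x‖ =
        Real.exp t * ‖linearizer x‖ * Real.exp (-(expPrimitive (flow xexp t x)).re) := by
      conv_lhs => rw [h1]
      rw [norm_mul, norm_mul, Complex.norm_exp, Complex.norm_real,
        Real.norm_of_nonneg (Real.exp_pos t).le, neg_re]
    rw [sub_zero, h2]
    conv_lhs => rw [h1, ← Complex.norm_mul_exp_arg_mul_I (linearizer x)]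
    have h3 : -expPrimitive (flow xexp t x) = ((-(expPrimitive (flow xexp t x)).re : ℝ) : ℂ) +
        ((-(expPrimitive (flow xexp t x)).im : ℝ) : ℂ) * I := by
      conv_lhs => rw [← Complex.re_add_im (expPrimitive (flow xexp t x))]
      push_cast; ring
    simp only [sub_eq_add_neg]
    rw [h3, Complex.exp_add, ofReal_add, add_mul, Complex.exp_add]
    push_cast
    ring
  · exact ((Complex.continuous_im.comp hE).tendsto 0).comp hlim |>.const_sub _

lemma frontier_repulsionBasin :
    frontier (repulsionBasin xexp 0) = upperCurve ∪ (starRingEnd ℂ) '' upperCurve := by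
  rw [repulsionBasin_eq_innerRegion, frontier_innerRegion]
  ext z
  have : z ∈ (starRingEnd ℂ) '' upperCurve ↔ starRingEnd ℂ z ∈ upperCurve :=
    ⟨by rintro ⟨w, hw, rfl⟩; simpa using hw, fun h => ⟨_, h, Complex.conj_conj z⟩⟩
  rw [mem_union, this]
  exact abs_im_eq_bdryHeight_iff

lemma mem_frontier_cases {z : ℂ} (hz : z ∈ frontier (repulsionBasin xexp 0)) :
    z ∈ upperCurve ∨ ∃ w ∈ upperCurve, z = starRingEnd ℂ w := by
  rw [frontier_repulsionBasin] at hz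
  exact hz.imp id fun ⟨w, h1, h2⟩ => ⟨w, h1, h2.symm⟩

lemma exists_isLeftwardSolution_of_mem_frontier {x : ℂ}
    (hx : x ∈ frontier (repulsionBasin xexp 0)) : ∃ T, IsLeftwardSolution x T := by
  rcases mem_frontier_cases hx with h | ⟨w, hw, rfl⟩
  · exact exists_isLeftwardSolution h
  · obtain ⟨T, hT⟩ := exists_isLeftwardSolution hw
    exact ⟨T, hT.conj⟩

lemma orbit_eq_of_mem_frontier {x : ℂ} (hx : x ∈ frontier (repulsionBasin xexp 0)) :
    orbit xexp x = {z ∈ frontier (repulsionBasin xexp 0) | 0 < z.im * x.im} := by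
  have hlow : ∀ w ∈ upperCurve, (starRingEnd ℂ w).im < 0 := fun w hw => by
    simpa using im_pos_of_mem_upperCurve hw
  rcases mem_frontier_cases hx with h | ⟨w, hw, rfl⟩
  · rw [orbit_eq_upperCurve h, frontier_repulsionBasin]
    have hx0 := im_pos_of_mem_upperCurve h
    ext z
    constructor
    · exact fun hz => ⟨Or.inl hz, mul_pos (im_pos_of_mem_upperCurve hz) hx0⟩
    · rintro ⟨hz | ⟨w, hw, rfl⟩, h2⟩
      · exact hz
      · nlinarith [hlow w hw]
  · rw [orbit_conj contDiff_xexp xexp_conj, orbit_eq_upperCurve hw, frontier_repulsionBasin]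
    have hx0 := hlow w hw
    ext z
    constructor
    · rintro ⟨v, hv, rfl⟩
      exact ⟨Or.inr ⟨v, hv, rfl⟩, mul_pos_of_neg_of_neg (hlow v hv) hx0⟩
    · rintro ⟨hz | hz, h2⟩
      · nlinarith [im_pos_of_mem_upperCurve hz]
      · exact hz

/-- The two orbits in the frontier are separated by the real axis. -/
lemma pathComponentIn_frontier {x : ℂ} (hx : x ∈ frontier (repulsionBasin xexp 0)) :
    pathComponentIn (frontier (repulsionBasin xexp 0)) x = orbit xexp x := by
  have him : ∀ z ∈ frontier (repulsionBasin xexp 0), z.im ≠ 0 := by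
    intro z hz
    rcases mem_frontier_cases hz with h | ⟨w, hw, rfl⟩
    · exact (im_pos_of_mem_upperCurve h).ne'
    · simpa using (im_pos_of_mem_upperCurve hw).ne'
  have horb := orbit_eq_of_mem_frontier hx
  refine Subset.antisymm (fun z hz => ?_) ?_
  · rw [horb]
    obtain ⟨p, hp⟩ := hz
    refine ⟨by simpa using hp 1, ?_⟩
    have hc : Continuous fun t => (p t).im * x.im := by fun_prop
    have := (isPreconnected_univ (α := unitInterval)).pos_of_ne_zero (s := 0) (t := 1)
      hc.continuousOn (fun t _ => mul_ne_zero (him _ (hp t)) (him x hx)) (mem_univ _)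
      (by simpa using mul_self_pos.2 (him x hx)) (mem_univ _)
    simpa using this
  · have hpath : IsPathConnected (orbit xexp x) :=
      ((ordConnected_maxInterval.convex).isPathConnected
        ⟨0, zero_mem_maxInterval contDiff_xexp x⟩).image' (continuousOn_flow contDiff_xexp x)
    exact hpath.subset_pathComponentIn (self_mem_orbit contDiff_xexp x)
      (horb.trans_subset (sep_subset _ _))

lemma not_isPositiveSeparatrix_of_mem_frontier {x : ℂ}
    (hx : x ∈ frontier (repulsionBasin xexp 0)) :
    ¬ IsPositiveSeparatrix xexp (orbit xexp x) := by
  rintro ⟨y, hy, hb⟩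
  have hyf : y ∈ frontier (repulsionBasin xexp 0) := by
    have : y ∈ orbit xexp x := hy ▸ self_mem_orbit contDiff_xexp y
    rw [orbit_eq_of_mem_frontier hx] at this
    exact this.1
  obtain ⟨T, hT⟩ := exists_isLeftwardSolution_of_mem_frontier hyf
  exact hT.not_isBounded hb

lemma not_twoSidedBlowUpClaim : ¬ TwoSidedBlowUpClaim := by
  intro hclaim
  set x : ℂ := (0 : ℝ) + bdryHeight 0 * I
  have hx : x ∈ frontier (repulsionBasin xexp 0) := by
    rw [frontier_repulsionBasin]
    left
    simp [upperCurve, x]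
  have hne : xexp ≠ 0 := fun h => one_ne_zero (xexp_eq_zero_iff.1 (congrFun h 1))
  obtain ⟨T, hT⟩ := exists_isLeftwardSolution_of_mem_frontier hx
  have hd : Differentiable ℂ xexp := differentiable_id.mul Complex.differentiable_exp
  exact not_isPositiveSeparatrix_of_mem_frontier hx
    (hclaim xexp hd hne 0 _ (Or.inr ⟨Or.inl isUnstableNode_xexp, rfl⟩) x hx
      (pathComponentIn_frontier hx) (Or.inr hT.isNegativeSeparatrix)).1

end Basin

theorem mainTheorem4 (F : ℂ → ℂ) (hF : F = fun x => x * Complex.exp x) :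
    -- `0` is the only equilibrium, and it is a repelling node
    (∀ a, F a = 0 ↔ a = 0) ∧ IsUnstableNode F 0 ∧
    -- the boundary of its basin: one orbit in the upper half-plane and its mirror image
    (∃ P : ℂ, (∀ z ∈ orbit F P, 0 < z.im) ∧
      frontier (repulsionBasin F 0) = orbit F P ∪ (starRingEnd ℂ) '' orbit F P) ∧
    (∀ x ∈ frontier (repulsionBasin F 0),
      -- the path component of `x` in the boundary is the orbit of `x`
      pathComponentIn (frontier (repulsionBasin F 0)) x = orbit F x ∧
      -- blow-up in finite negative time, towards `+∞` through the right half-plane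
      IsNegativeSeparatrix F (orbit F x) ∧ HasNegativeBlowUp F x ∧
      (∃ T < 0, maxInterval F x = Ioi T ∧
        Tendsto (fun t => (flow F t x).re) (𝓝[>] T) atTop) ∧
      -- towards `-∞` along the negative real axis in positive time
      Tendsto (fun t => (flow F t x).re) atTop atBot ∧
      Tendsto (fun t => (flow F t x).im) atTop (𝓝 0) ∧
      -- the transit time towards `-∞` is infinite
      (∀ M : ℝ, ∃ R : ℝ, ∀ y ∈ posOrbit F x, y.re < R → M < transitTime F x y) ∧
      ¬ BddAbove (transitTime F x '' posOrbit F x) ∧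
      -- no blow-up in finite positive time
      ¬ IsPositiveSeparatrix F (orbit F x) ∧ ¬ HasPositiveBlowUp F x) ∧
    ¬ TwoSidedBlowUpClaim := by
  obtain rfl : F = xexp := hF
  refine ⟨fun a => xexp_eq_zero_iff, isUnstableNode_xexp, ?_, fun x hx => ?_,
    not_twoSidedBlowUpClaim⟩
  · have hP : ((0 : ℝ) + bdryHeight 0 * Complex.I : ℂ) ∈ upperCurve := by simp [upperCurve]
    refine ⟨(0 : ℝ) + bdryHeight 0 * Complex.I, ?_⟩
    rw [orbit_eq_upperCurve hP]
    exact ⟨fun z hz => im_pos_of_mem_upperCurve hz, frontier_repulsionBasin⟩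
  · obtain ⟨T, hT⟩ := exists_isLeftwardSolution_of_mem_frontier hx
    exact ⟨pathComponentIn_frontier hx, hT.isNegativeSeparatrix, hT.hasNegativeBlowUp,
      ⟨T, hT.neg, hT.maxInterval_eq, hT.tendsto_re_start⟩, hT.tendsto_re_atTop, hT.tendsto_im_atTop,
      hT.exists_lt_transitTime, hT.not_bddAbove_transitTime,
      not_isPositiveSeparatrix_of_mem_frontier hx, hT.not_hasPositiveBlowUp⟩
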